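/- Let $\mathcal H$ be a complex Hilbert space. Let $\mathbf t_0$ and $\mathbf a$ be densely defined sesquilinear forms in $\mathcal H$ such that $\mathbf t_0$ is closed, $\mathbf t_0\ge\kappa_0\ge 0$, $\mathbf a\ge\alpha_0\ge 0$ and $\operatorname{dom}\mathbf t_0\subseteq\operatorname{dom}\mathbf a$ (here $\mathbf b\ge\gamma$ means that $\mathbf b$ is symmetric and $\mathbf b[f]\ge\gamma\|f\|^2$ for $f\in\operatorname{dom}\mathbf b$, where $\mathbf b[f]:=\mathbf b[f,f]$). Let $$\mathbf t(\lambda):=\mathbf t_0+2\lambda\mathbf a+\lambda^2,\qquad \operatorname{dom}\mathbf t(\lambda):=\operatorname{dom}\mathbf t_0,\qquad \lambda\in\mathbb C .$$ Suppose that there are $\kappa\le\kappa_0$, $p\in(0,1)$ and $C_p>0$ with $$\mathbf a[f]\le C_p\big(\mathbf t_0[f]-\kappa\|f\|^2\big)^p\big(\|f\|^2\big)^{1-p},\qquad f\in\operatorname{dom}\mathbf t_0 .$$ Then $\mathbf t$ is holomorphic of type (a), i.e. all $\mathbf t(\lambda)$ are sectorial and closed with a common dense domain, and $\lambda\mapsto\mathbf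 t(\lambda)[f]$ is holomorphic for each $f$ in it. Let $T(\lambda)$ be the operator associated with $\mathbf t(\lambda)$: $u\in\operatorname{dom}T(\lambda)$ and $T(\lambda)u=w$ if and only if $u\in\operatorname{dom}\mathbf t_0$ and $\mathbf t(\lambda)[u,v]=(w,v)$ for all $v\in\operatorname{dom}\mathbf t_0$. Put $\sigma(T):=\{\lambda\in\mathbb C: 0\in\sigma(T(\lambda))\}$, $W(T):=\{\lambda\in\mathbb C:\exists f\in\operatorname{dom}T(\lambda),\ f\neq0,\ (T(\lambda)f,f)=0\}$ and $W_\Psi(T):=\bigcap_{\varepsilon>0}\ \bigcup_{B\in L(\mathcal H),\,\|B\|<\varepsilon}W(T+B)$. Then $$\sigma(T)\subseteq W_\Psi(T)\subseteq\{z\in\mathbb C:\operatorname{Re}z\le0\},$$ and the following enclosures hold. (i) $\sigma(T)\setminus\mathbb R\subseteq W_\Psi(T)\setminus\mathbb R$, and $W_\Psi(T)\setminus\mathbb R$ is contained in $$\Big\{z\in\mathbb C:\operatorname{Re}z\le-\alpha_0,\ |z|\ge\sqrt{\kappa_0},\ |\operatorname{Im}z|\ge\sqrt{\max\big\{0,\,C_p^{-1/p}|\operatorname{Re}z|^{1/p}-|\operatorname{Re}z|^2+\kappa\big\}}\Big\}.$$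 (ii) Let $$D:=\{x\in[\kappa_0,\infty):C_p^{-1/p}x^{1/(2p)}-x+\kappa\le0\},\qquad g_\pm(t):=-C_p(t-\kappa)^p\pm\sqrt{C_p^2(t-\kappa)^{2p}-t}\,.$$ * If $p<\frac12$, or $p=\frac12$ and $C_p<1$, or $p=\frac12$, $C_p=1$ and $\kappa>0$, then either $D=\emptyset$ and $\sigma(T)\cap\mathbb R=\emptyset$, or $s^-:=\min_Dg_-$ and $s^+:=\max_Dg_+$ exist, $s^-\le s^+\le0$, and $\sigma(T)\cap\mathbb R\subseteq[s^-,s^+]$. * If $p>\frac12$, or $p=\frac12$ and $C_p>1$, or $p=\frac12$, $C_p=1$ and $\kappa\le0$, then one of the following holds: either $D=[\kappa_0,x_-]\cup[x_+,\infty)$ with some $\kappa_0\le x_-<x_+$, the numbers $r^+:=\max_{[x_+,\infty)}g_+$, $s^-:=\min_{[\kappa_0,x_-]}g_-$ and $s^+:=\max_{[\kappa_0,x_-]}g_+$ exist, $-\infty<r^+<s^-\le s^+\le0$, and $\sigma(T)\cap\mathbb R\subseteq(-\infty,r^+]\cup[s^-,s^+]$; or $D=[x,\infty)$ with some $x\ge\kappa_0$,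 the number $s^+:=\max_{[x,\infty)}g_+$ exists, $s^+\le0$, and $\sigma(T)\cap\mathbb R\subseteq(-\infty,s^+]$. In particular, $r^+$, $s^-$ and $s^+$ depend only on $p$, $C_p$, $\kappa_0$ and $\kappa$. In (iii) and (v), let $t_0:=\max\big\{\big(4C_p^2p(1-p)\big)^{-\frac1{2p-1}},\kappa_0\big\}$. (iii) If $\kappa=0$ and $p<\frac12$, then $\sigma(T)\cap\mathbb R=\emptyset$ if $(C_p^2)^{\frac1{1-2p}}<\kappa_0$, and $$\sigma(T)\cap\mathbb R\subseteq\Big[-C_pt_0^p-\sqrt{C_p^2t_0^{2p}-t_0}\,,\ -C_p\kappa_0^p+\sqrt{C_p^2\kappa_0^{2p}-\kappa_0}\Big]\quad\text{if }(C_p^2)^{\frac1{1-2p}}\ge\kappa_0 .$$ (iv) If $\kappa=0$ and $p=\frac12$, then $\sigma(T)\cap\mathbb R=\emptyset$ if $C_p<1$ and $\kappa_0>0$; $\sigma(T)\cap\mathbb R\subseteq\{0\}$ if $C_p<1$ and $\kappa_0=0$; and $\sigma(T)\cap\mathbb R\subseteq\big(-\infty,-\big(C_p-\sqrt{C_p^2-1}\big)\kappa_0^{1/2}\big]$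 if $C_p\ge1$. (v) If $\kappa=0$ and $p>\frac12$, then $\sigma(T)\cap\mathbb R\subseteq\big(-\infty,-C_pt_0^p+\sqrt{C_p^2t_0^{2p}-t_0}\,\big]$ if $\kappa_0>0$, and $\sigma(T)\cap\mathbb R\subseteq\big(-\infty,-C_pt_0^p+\sqrt{C_p^2t_0^{2p}-t_0}\,\big]\cup\{0\}$ if $\kappa_0=0$. -/

import Mathlib

open Filter Topology

/-- A sesquilinear form in `H`, defined on a linear subspace; linear in the first and conjugate
linear in the second argument. -/
structure SesqForm (H : Type*) [NormedAddCommGroup H] [InnerProductSpace ℂ H] where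
  domain : Submodule ℂ H
  toFun : domain →ₗ[ℂ] domain →ₛₗ[starRingEnd ℂ] ℂ

namespace SesqForm

variable {H : Type*} [NormedAddCommGroup H] [InnerProductSpace ℂ H]

/-- The quadratic form `t[f] = t[f, f]`. -/
def quad (t : SesqForm H) (f : t.domain) : ℂ := t.toFun f f

def DenselyDefined (t : SesqForm H) : Prop := Dense (t.domain : Set H)

def IsSymmetric (t : SesqForm H) : Prop :=
  ∀ f g : t.domain, t.toFun f g = starRingEnd ℂ (t.toFun g f)

/-- `t ≥ γ`: the form is symmetric and `t[f] ≥ γ ‖f‖²` on its domain. -/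
def BoundedBelowBy (t : SesqForm H) (γ : ℝ) : Prop :=
  t.IsSymmetric ∧ ∀ f : t.domain, γ * ‖(f : H)‖ ^ 2 ≤ (t.quad f).re

/-- The numerical range `{t[f] : f ∈ dom t, ‖f‖ = 1}` of a form. -/
def numRange (t : SesqForm H) : Set ℂ := {z | ∃ f : t.domain, ‖(f : H)‖ = 1 ∧ t.quad f = z}

/-- The numerical range lies in a sector with vertex `γ ∈ ℝ` and semi-angle `θ ∈ [0, π/2)`
(the vertex itself belongs to the sector, as `Complex.arg 0 = 0`). -/
def IsSectorial (t : SesqForm H) : Prop :=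
  ∃ γ θ : ℝ, 0 ≤ θ ∧ θ < Real.pi / 2 ∧ ∀ z ∈ t.numRange, |(z - (γ : ℂ)).arg| ≤ θ

/-- Closedness: if `uₙ ∈ dom t`, `uₙ → x` in `H` and `t[uₙ - uₘ] → 0`, then `x ∈ dom t` and
`t[uₙ - x] → 0`. -/
def IsClosedForm (t : SesqForm H) : Prop :=
  ∀ (u : ℕ → t.domain) (x : H), Tendsto (fun n => (u n : H)) atTop (𝓝 x) →
    Tendsto (fun nm : ℕ × ℕ => t.quad (u nm.1 - u nm.2)) atTop (𝓝 0) →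
    ∃ hx : x ∈ t.domain, Tendsto (fun n => t.quad (u n - ⟨x, hx⟩)) atTop (𝓝 0)

/-- A family of forms on `ℂ` is holomorphic of type (a): the forms are sectorial and closed with
one common dense domain `D`, and `λ ↦ t(λ)[u]` is holomorphic for each fixed `u ∈ D`. -/
def HolomorphicTypeA (t : ℂ → SesqForm H) : Prop :=
  (∀ l, (t l).IsSectorial ∧ (t l).IsClosedForm) ∧
    ∃ (D : Submodule ℂ H) (hD : ∀ l, D = (t l).domain), Dense (D : Set H) ∧
      ∀ u : D, Differentiable ℂ fun l => (t l).quad ⟨(u : H), hD l ▸ u.2⟩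

/-- The form `t₀ + 2 λ a + λ²` with domain `dom t₀ ⊆ dom a`; explicitly
`t(λ)[f, g] = t₀[f, g] + 2 λ a[f, g] + λ² (f, g)`. -/
noncomputable def pencil (t₀ a : SesqForm H) (h : t₀.domain ≤ a.domain) (l : ℂ) : SesqForm H where
  domain := t₀.domain
  toFun := LinearMap.mk₂'ₛₗ (RingHom.id ℂ) (starRingEnd ℂ)
    (fun f g => t₀.toFun f g + 2 * l * a.toFun ⟨f, h f.2⟩ ⟨g, h g.2⟩
      + l ^ 2 * inner ℂ (g : H) (f : H))
    (fun f₁ f₂ g => by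
      have e : (⟨((f₁ + f₂ : t₀.domain) : H), h (f₁ + f₂).2⟩ : a.domain)
        = ⟨f₁, h f₁.2⟩ + ⟨f₂, h f₂.2⟩ := rfl
      rw [e]
      simp only [map_add, LinearMap.add_apply, Submodule.coe_add, inner_add_right]
      ring)
    (fun c f g => by
      have e : (⟨((c • f : t₀.domain) : H), h (c • f).2⟩ : a.domain) = c • ⟨f, h f.2⟩ := rfl
      rw [e]
      simp only [map_smul, LinearMap.smul_apply, Submodule.coe_smul, inner_smul_right,
        smul_eq_mul, RingHom.id_apply]
      ring)
    (fun f g₁ g₂ => by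
      have e : (⟨((g₁ + g₂ : t₀.domain) : H), h (g₁ + g₂).2⟩ : a.domain)
        = ⟨g₁, h g₁.2⟩ + ⟨g₂, h g₂.2⟩ := rfl
      rw [e]
      simp only [map_add, Submodule.coe_add, inner_add_left]
      ring)
    (fun c f g => by
      have e : (⟨((c • g : t₀.domain) : H), h (c • g).2⟩ : a.domain) = c • ⟨g, h g.2⟩ := rfl
      rw [e]
      simp only [LinearMap.map_smulₛₗ, Submodule.coe_smul, inner_smul_left, smul_eq_mul]
      ring)

/-- The graph `{(u, w) : u ∈ dom t, t[u, v] = (w, v) for all v ∈ dom t}`. -/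
def operatorGraph (t : SesqForm H) : Submodule ℂ (H × H) where
  carrier := {x | ∃ hx : x.1 ∈ t.domain, ∀ v : t.domain, t.toFun ⟨x.1, hx⟩ v = inner ℂ (v : H) x.2}
  add_mem' := by
    rintro x y ⟨hx, hx'⟩ ⟨hy, hy'⟩
    refine ⟨t.domain.add_mem hx hy, fun v => ?_⟩
    have e : (⟨(x + y).1, t.domain.add_mem hx hy⟩ : t.domain) = ⟨x.1, hx⟩ + ⟨y.1, hy⟩ := rfl
    rw [e, map_add, LinearMap.add_apply, hx', hy', Prod.snd_add, inner_add_right]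
  zero_mem' := by
    refine ⟨t.domain.zero_mem, fun v => ?_⟩
    have e : (⟨(0 : H × H).1, t.domain.zero_mem⟩ : t.domain) = 0 := rfl
    rw [e]
    simp
  smul_mem' := by
    rintro c x ⟨hx, hx'⟩
    refine ⟨t.domain.smul_mem c hx, fun v => ?_⟩
    have e : (⟨(c • x).1, t.domain.smul_mem c hx⟩ : t.domain) = c • ⟨x.1, hx⟩ := rfl
    rw [e, map_smul, LinearMap.smul_apply, hx', Prod.smul_snd, inner_smul_right, smul_eq_mul]

/-- The operator associated with a densely defined form by the first representation theorem:
its domain consists of the `u ∈ dom t` for which some `w` satisfies `t[u, v] = (w, v)` for all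
`v ∈ dom t`, and it maps `u` to this `w`. -/
noncomputable def operator (t : SesqForm H) : H →ₗ.[ℂ] H := t.operatorGraph.toLinearPMap

/-- For a densely defined form, `operator` has the intended graph. -/
theorem operator_graph (t : SesqForm H) (ht : t.DenselyDefined) :
    t.operator.graph = t.operatorGraph := by
  refine Submodule.toLinearPMap_graph_eq _ ?_
  rintro ⟨u, w⟩ ⟨hu, h⟩ hu0
  have hu0' : u = 0 := hu0
  subst hu0'
  have e : (⟨0, hu⟩ : t.domain) = 0 := rfl
  refine Dense.eq_zero_of_inner_left ℂ ht fun v hv => ?_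
  have h' := h ⟨v, hv⟩
  simp only [e, map_zero, LinearMap.zero_apply] at h'
  rw [← inner_conj_symm, ← h', map_zero]

end SesqForm

namespace OpFamily

variable {H : Type*} [NormedAddCommGroup H] [InnerProductSpace ℂ H]

/-- `0 ∈ ρ(A)`: the operator `A : dom A → H` is bijective with bounded inverse. -/
def HasBoundedInverse (A : H →ₗ.[ℂ] H) : Prop :=
  ∃ S : H →L[ℂ] H, (∀ y, ∃ hy : S y ∈ A.domain, A ⟨S y, hy⟩ = y) ∧ ∀ x : A.domain, S (A x) = x

/-- The spectrum `{λ : 0 ∈ σ(T(λ))}` of an operator family. -/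
def spectrum (T : ℂ → H →ₗ.[ℂ] H) : Set ℂ := {l | ¬ HasBoundedInverse (T l)}

/-- The real spectrum `σ(T) ∩ ℝ`, as a set of real numbers. -/
def realSpectrum (T : ℂ → H →ₗ.[ℂ] H) : Set ℝ := {x | (x : ℂ) ∈ spectrum T}

/-- The numerical range `{λ : ∃ f ∈ dom T(λ), f ≠ 0, (T(λ) f, f) = 0}` of an operator family. -/
def numRange (T : ℂ → H →ₗ.[ℂ] H) : Set ℂ :=
  {l | ∃ f : (T l).domain, (f : H) ≠ 0 ∧ inner ℂ (f : H) (T l f) = 0}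

/-- The `ε`-pseudo numerical range, the union of `W(T + B)` over bounded `B` with `‖B‖ < ε`;
here `B +ᵥ T l` is the operator `T(l) + B` with domain `dom T(l)`. -/
def epsPseudoNumRange (T : ℂ → H →ₗ.[ℂ] H) (ε : ℝ) : Set ℂ :=
  ⋃ B ∈ {B : H →L[ℂ] H | ‖B‖ < ε}, numRange fun l => (B : H →ₗ[ℂ] H) +ᵥ T l

/-- The pseudo numerical range `W_Ψ(T)`. -/
def pseudoNumRange (T : ℂ → H →ₗ.[ℂ] H) : Set ℂ :=
  ⋂ ε ∈ Set.Ioi (0 : ℝ), epsPseudoNumRange T ε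

end OpFamily

namespace PencilBounds

/-- The set of all `x ≥ κ₀` with `d(x) = C^(-1/p) x^(1/(2p)) - x + κ ≤ 0`. -/
def D (p C κ κ₀ : ℝ) : Set ℝ :=
  {x | κ₀ ≤ x ∧ C ^ (-1 / p) * x ^ (1 / (2 * p)) - x + κ ≤ 0}

/-- `g₊(t) = -C (t - κ)^p + √(C² (t - κ)^(2p) - t)`. -/
noncomputable def gPlus (p C κ t : ℝ) : ℝ :=
  -(C * (t - κ) ^ p) + √(C ^ 2 * (t - κ) ^ (2 * p) - t)

/-- `g₋(t) = -C (t - κ)^p - √(C² (t - κ)^(2p) - t)`. -/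
noncomputable def gMinus (p C κ t : ℝ) : ℝ :=
  -(C * (t - κ) ^ p) - √(C ^ 2 * (t - κ) ^ (2 * p) - t)

/-- `max {(4 C² p (1 - p))^(-1/(2p - 1)), κ₀}`. -/
noncomputable def tZero (p C κ₀ : ℝ) : ℝ :=
  max ((4 * C ^ 2 * p * (1 - p)) ^ (-1 / (2 * p - 1))) κ₀

end PencilBounds

/-!
The proof has a functional-analytic half and a scalar half.

By subordination with exponent `p < 1`, the form `a` has relative bound `0` with respect to `t₀`
(`SesqForm.isRelativelySmall_of_rpow`). Hence `|Im t(l)[f]| + t₀[f] / 2 ≤ Re t(l)[f] + K ‖f‖²`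
(`SesqForm.exists_abs_im_add_le_re`), which yields sectoriality and closedness, and ellipticity of
`t(l)` on the Hilbert space `dom t₀` with inner product `t₀[·,·] + (·,·)`. If `l` is not in the
pseudo numerical range, then `|t(l)[f]| ≥ ε ‖f‖²` on the operator domain
(`OpFamily.mem_pseudoNumRange_iff`). The operator domain is dense in the form space, so the bound
extends to all of `dom t₀`; together with ellipticity, `|t(l)[f]|` dominates the squared norm of the
form space, and a Lax–Milgram argument inverts the operator (`exists_resolvent_of_lower_bound`).
So the spectrum lies in the pseudo numerical range; no convexity of numerical ranges is needed.

A point `l` of the pseudo numerical range is an approximate zero of `τ + 2 l α + l²`, where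
`τ = t₀[f] ≥ κ₀` and `α₀ ≤ α = a[f] ≤ C (τ - κ)^p` for unit vectors `f`. If `l` is nonreal, the
imaginary and the real part force `α → -Re l` and `τ → |l|²`, and the constraints pass to the limit.
If `l = z` is real, compactness gives `z ≤ 0` and some `t ≥ κ₀` with
`z² + 2 C (t - κ)^p z + t ≤ 0` (`PencilBounds.realRegion`), that is, `t ∈ D` and
`g₋(t) ≤ z ≤ g₊(t)`.

In the bounded case `D` is compact; in the unbounded case its shape follows from the concavity of
its defining function. If `D` has two components, the strict separation holds since, for fixed `z ≤
0`, the set of admissible `t` is an interval and so cannot jump over the gap of `D`. For `κ = 0` and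
`p ≤ 1/2` the upper bound expresses that `g₊` is antitone; the bounds in terms of
`PencilBounds.tZero` come from the weighted inequality between the arithmetic and the geometric mean
when the extremal point `t⋆` of `g±` is at least `κ₀`, and from the tangent of `t ↦ t^p` at `κ₀`
otherwise.
-/

/-! ### Elementary real analysis of `D` and `g±` -/

namespace PencilBounds

/-- A power `s ^ q` with `0 ≤ q < 1` is bounded by an arbitrarily small multiple of `s`, up to an
additive constant. -/
theorem exists_mul_rpow_le {q A δ : ℝ} (hq0 : 0 ≤ q) (hq1 : q < 1) (hA : 0 ≤ A) (hδ : 0 < δ) :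
    ∃ K, 0 ≤ K ∧ ∀ s, 0 ≤ s → A * s ^ q ≤ δ * s + K := by
  have h1 : 0 < 1 - q := by linarith
  set s₀ : ℝ := (A / δ) ^ (1 - q)⁻¹ with hs₀
  have hAδ : 0 ≤ A / δ := by positivity
  have hs₀0 : 0 ≤ s₀ := Real.rpow_nonneg hAδ _
  refine ⟨A * s₀ ^ q, by positivity, fun s hs => ?_⟩
  rcases le_total s s₀ with h | h
  · have := Real.rpow_le_rpow hs h hq0
    nlinarith [mul_nonneg hδ.le hs, mul_le_mul_of_nonneg_left this hA]
  · rcases hs.eq_or_lt with rfl | hs'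
    · have h0 : s₀ = 0 := le_antisymm h hs₀0
      rw [h0]; simp
    · have h2 : A / δ ≤ s ^ (1 - q) := (Real.rpow_inv_le_iff_of_pos hAδ hs h1).1 h
      have h3 : s ^ (1 - q) * s ^ q = s := by
        rw [← Real.rpow_add hs']; simp
      have h4 : A ≤ δ * s ^ (1 - q) := by
        rw [div_le_iff₀ hδ] at h2; linarith
      have h5 : 0 ≤ s ^ q := Real.rpow_nonneg hs _
      have h6 : 0 ≤ A * s₀ ^ q := by positivity
      calc A * s ^ q ≤ δ * s ^ (1 - q) * s ^ q := mul_le_mul_of_nonneg_right h4 h5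
        _ = δ * s := by rw [mul_assoc, h3]
        _ ≤ _ := by linarith

theorem sq_mul_rpow {C s p : ℝ} (hs : 0 ≤ s) : (C * s ^ p) ^ 2 = C ^ 2 * s ^ (2 * p) := by
  rw [mul_pow, mul_comm 2 p, Real.rpow_mul hs]; norm_num

/-- A real quadratic with leading coefficient `1` is nonpositive exactly between its roots. -/
theorem quadratic_nonpos_iff {b t z : ℝ} :
    z ^ 2 + 2 * b * z + t ≤ 0 ↔ t ≤ b ^ 2 ∧ -b - √(b ^ 2 - t) ≤ z ∧ z ≤ -b + √(b ^ 2 - t) := by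
  constructor
  · intro h
    have h1 : (z + b) ^ 2 ≤ b ^ 2 - t := by nlinarith
    have h2 := Real.abs_le_sqrt h1
    rw [abs_le] at h2
    exact ⟨by nlinarith [sq_nonneg (z + b)], by linarith, by linarith⟩
  · rintro ⟨h0, h1, h2⟩
    have h3 : |z + b| ≤ √(b ^ 2 - t) := abs_le.2 ⟨by linarith, by linarith⟩
    have h4 := sq_le_sq' (by linarith [neg_abs_le (z + b), abs_le.1 h3]) (abs_le.1 h3).2
    rw [Real.sq_sqrt (by linarith)] at h4
    nlinarith

section

variable {p C κ κ₀ t z : ℝ}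

/-- For `t ≥ κ₀`, membership in `D` says that the radicand in `g₊` and `g₋` is nonnegative. -/
theorem mem_D_iff (hκ₀ : 0 ≤ κ₀) (hκ : κ ≤ κ₀) (hp : 0 < p) (hC : 0 < C) :
    t ∈ D p C κ κ₀ ↔ κ₀ ≤ t ∧ t ≤ C ^ 2 * (t - κ) ^ (2 * p) := by
  refine and_congr_right fun ht => ?_
  have hs : 0 ≤ t - κ := by linarith
  have ht0 : 0 ≤ t := hκ₀.trans ht
  have hCp : 0 < C ^ (1 / p) := Real.rpow_pos_of_pos hC _
  have e1 : C ^ (-1 / p) = (C ^ (1 / p))⁻¹ := by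
    rw [← Real.rpow_neg hC.le]; congr 1; ring
  have e2 : (C ^ (1 / p) * (t - κ)) ^ (2 * p) = C ^ 2 * (t - κ) ^ (2 * p) := by
    rw [Real.mul_rpow hCp.le hs, ← Real.rpow_mul hC.le]
    congr 1
    rw [show 1 / p * (2 * p) = (2 : ℕ) by field_simp; norm_num, Real.rpow_natCast]
  have e3 : t ^ (1 / (2 * p)) = t ^ (2 * p)⁻¹ := by rw [one_div]
  rw [← e2, ← Real.rpow_inv_le_iff_of_pos ht0 (by positivity) (by positivity), e1, e3,
    ← inv_mul_le_iff₀ hCp]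
  constructor <;> intro h <;> linarith

/-- The numbers `g₋(t) ≤ g₊(t)` are the roots of `z² + 2 C (t - κ)^p z + t`. -/
theorem quadratic_nonpos_iff_mem_Icc (hs : κ ≤ t) :
    z ^ 2 + 2 * (C * (t - κ) ^ p) * z + t ≤ 0 ↔
      t ≤ C ^ 2 * (t - κ) ^ (2 * p) ∧ gMinus p C κ t ≤ z ∧ z ≤ gPlus p C κ t := by
  rw [quadratic_nonpos_iff, sq_mul_rpow (by linarith : 0 ≤ t - κ)]
  rfl

theorem gMinus_le_gPlus : gMinus p C κ t ≤ gPlus p C κ t := by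
  unfold gMinus gPlus
  linarith [Real.sqrt_nonneg (C ^ 2 * (t - κ) ^ (2 * p) - t)]

theorem gPlus_nonpos (hC : 0 < C) (ht : 0 ≤ t) (hs : κ ≤ t) : gPlus p C κ t ≤ 0 := by
  have hs' : 0 ≤ t - κ := by linarith
  have h0 : 0 ≤ C * (t - κ) ^ p := by positivity
  have h1 : √(C ^ 2 * (t - κ) ^ (2 * p) - t) ≤ C * (t - κ) ^ p := by
    rw [Real.sqrt_le_left h0, sq_mul_rpow hs']; linarith
  unfold gPlus; linarith

theorem continuous_sub_rpow (κ : ℝ) {q : ℝ} (hq : 0 ≤ q) : Continuous fun t : ℝ => (t - κ) ^ q :=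
  (continuous_id.sub continuous_const).rpow_const fun _ => Or.inr hq

theorem continuous_gPlus (hp : 0 < p) : Continuous (gPlus p C κ) :=
  (continuous_const.mul (continuous_sub_rpow κ hp.le)).neg.add
    ((continuous_const.mul (continuous_sub_rpow κ (by positivity))).sub continuous_id).sqrt

theorem continuous_gMinus (hp : 0 < p) : Continuous (gMinus p C κ) :=
  (continuous_const.mul (continuous_sub_rpow κ hp.le)).neg.sub
    ((continuous_const.mul (continuous_sub_rpow κ (by positivity))).sub continuous_id).sqrt

theorem isClosed_D (hp : 0 < p) : IsClosed (D p C κ κ₀) := by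
  have h : Continuous fun x : ℝ => C ^ (-1 / p) * x ^ (1 / (2 * p)) - x + κ :=
    ((continuous_const.mul (continuous_id.rpow_const fun _ => Or.inr (by positivity))).sub
      continuous_id).add continuous_const
  exact isClosed_Ici.inter (isClosed_le h continuous_const)

/-- Where its radicand is nonnegative, `g₊(t) ≤ -t / (2 C (t - κ)^p)`, which tends to `-∞` since
`p < 1`. -/
theorem tendsto_gPlus (hp0 : 0 < p) (hp1 : p < 1) (hC : 0 < C)
    (h : ∀ᶠ t in atTop, t ≤ C ^ 2 * (t - κ) ^ (2 * p)) :
    Tendsto (gPlus p C κ) atTop atBot := by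
  have hs : Tendsto (fun t : ℝ => t - κ) atTop atTop := tendsto_atTop_add_const_right _ _ tendsto_id
  have h1 : Tendsto (fun t : ℝ => ((t - κ) ^ (1 - p) + κ * (t - κ) ^ (-p)) / (2 * C))
      atTop atTop := by
    refine Tendsto.atTop_div_const (by positivity) ?_
    exact ((tendsto_rpow_atTop (by linarith : 0 < 1 - p)).comp hs).atTop_add
      (((tendsto_rpow_neg_atTop hp0).comp hs).const_mul κ)
  refine tendsto_atBot_mono' _ ?_ (tendsto_neg_atTop_atBot.comp h1)
  filter_upwards [h, eventually_gt_atTop κ, eventually_gt_atTop 0] with t ht htκ ht0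
  have hs : 0 < t - κ := by linarith
  have hb : 0 < C * (t - κ) ^ p := by positivity
  have e : ((t - κ) ^ (1 - p) + κ * (t - κ) ^ (-p)) / (2 * C) = t / (2 * (C * (t - κ) ^ p)) := by
    rw [Real.rpow_sub hs, Real.rpow_neg hs.le, Real.rpow_one]
    field_simp
    ring
  have key : √(C ^ 2 * (t - κ) ^ (2 * p) - t)
      ≤ C * (t - κ) ^ p - t / (2 * (C * (t - κ) ^ p)) := by
    rw [← sq_mul_rpow hs.le] at ht ⊢
    generalize C * (t - κ) ^ p = b at *
    have h2 : t / (2 * b) ≤ b := by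
      rw [div_le_iff₀ (by positivity)]; nlinarith
    rw [Real.sqrt_le_left (by linarith)]
    have h3 : t / (2 * b) * b = t / 2 := by field_simp
    nlinarith [sq_nonneg (t / (2 * b))]
  simp only [Function.comp, e]
  unfold gPlus
  linarith

end

theorem exists_isGreatest_image_Ici {f : ℝ → ℝ} (hf : Continuous f)
    (h : Tendsto f atTop atBot) (x : ℝ) : ∃ m, IsGreatest (f '' Set.Ici x) m := by
  obtain ⟨M, hM⟩ := (eventually_atTop.1 (h.eventually_le_atBot (f x)))
  obtain ⟨y, hy, hmax⟩ := isCompact_Icc.exists_isMaxOn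
    (Set.nonempty_Icc.2 (le_max_left x M)) hf.continuousOn
  refine ⟨f y, ⟨y, hy.1, rfl⟩, ?_⟩
  rintro _ ⟨z, hz, rfl⟩
  rcases le_total z (max x M) with hz' | hz'
  · exact hmax ⟨hz, hz'⟩
  · exact (hM z ((le_max_right _ _).trans hz')).trans (hmax ⟨le_rfl, le_max_left _ _⟩)

/-- A sublevel set on a half-line of a concave function that is eventually nonpositive misses one
bounded interval at most. -/
theorem sublevel_eq_of_concaveOn {d : ℝ → ℝ} {k M : ℝ} (hd : Continuous d)
    (hcv : ConcaveOn ℝ (Set.Ici k) d) (hM : ∀ x, M ≤ x → d x ≤ 0) :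
    (∃ x, k ≤ x ∧ {x | k ≤ x ∧ d x ≤ 0} = Set.Ici x) ∨
      ∃ xm xp, k ≤ xm ∧ xm < xp ∧ {x | k ≤ x ∧ d x ≤ 0} = Set.Icc k xm ∪ Set.Ici xp := by
  set G : Set ℝ := {x ∈ Set.Ici k | 0 < d x} with hG
  have hconv : G.OrdConnected := (hcv.convex_gt 0).ordConnected
  rcases G.eq_empty_or_nonempty with hGe | hGn
  · refine Or.inl ⟨k, le_rfl, Set.ext fun x => ⟨fun hx => hx.1, fun hx => ⟨hx, ?_⟩⟩⟩
    by_contra hx'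
    have : x ∈ G := ⟨hx, not_le.1 hx'⟩
    simp [hGe] at this
  have hba : BddAbove G := ⟨M, fun x hx => by
    by_contra h'
    exact absurd (hM x (not_le.1 h').le) (not_le.2 hx.2)⟩
  have hbb : BddBelow G := ⟨k, fun x hx => hx.1⟩
  have hkG : ∀ x ∈ G, k ≤ x := fun x hx => hx.1
  have hop : IsOpen {x | 0 < d x} := isOpen_lt continuous_const hd
  obtain ⟨g₀, hg₀⟩ := hGn
  have hksup : k ≤ sSup G := hg₀.1.trans (le_csSup hba hg₀)
  have hsup : d (sSup G) ≤ 0 := by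
    by_contra h'
    obtain ⟨u, hu, hu'⟩ := (mem_nhds_iff_exists_Ioo_subset.1 (hop.mem_nhds (not_le.1 h')))
    obtain ⟨v, hv1, hv2⟩ := exists_between hu'.1.2
    have : v ∈ G := ⟨hksup.trans hv1.le, hu'.2 ⟨hu'.1.1.trans hv1, hv2⟩⟩
    exact absurd (le_csSup hba this) (not_le.2 hv1)
  have hright : ∀ x, sSup G ≤ x → d x ≤ 0 := fun x hx => by
    by_contra h'
    have hxG : x ∈ G := ⟨hksup.trans hx, not_le.1 h'⟩
    have : x = sSup G := le_antisymm (le_csSup hba hxG) hx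
    exact h' (this ▸ hsup)
  by_cases hk : k ∈ G
  · refine Or.inl ⟨sSup G, hksup, Set.ext fun x => ⟨fun hx => ?_, fun hx =>
      ⟨hksup.trans hx, hright x hx⟩⟩⟩
    by_contra h'
    obtain ⟨g, hg, hxg⟩ := exists_lt_of_lt_csSup ⟨g₀, hg₀⟩ (not_le.1 h')
    exact absurd hx.2 (not_le.2 (hconv.out hk hg ⟨hx.1, hxg.le⟩).2)
  · have hkinf : k ≤ sInf G := le_csInf ⟨g₀, hg₀⟩ hkG
    have hinf : d (sInf G) ≤ 0 := by
      by_contra h'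
      rcases hkinf.eq_or_lt with h0 | h0
      · exact hk ⟨Set.mem_Ici.2 le_rfl, h0 ▸ not_le.1 h'⟩
      obtain ⟨u, w, hu', huw⟩ := (mem_nhds_iff_exists_Ioo_subset.1 (hop.mem_nhds (not_le.1 h')))
      obtain ⟨v, hv1, hv2⟩ := exists_between (max_lt h0 hu'.1)
      have : v ∈ G := ⟨(le_max_left _ _).trans hv1.le,
        huw ⟨(le_max_right _ _).trans_lt hv1, hv2.trans hu'.2⟩⟩
      exact absurd (csInf_le hbb this) (not_le.2 hv2)
    have hg₀sup : g₀ < sSup G := lt_of_le_of_ne (le_csSup hba hg₀) fun h' =>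
      absurd hsup (not_le.2 (h' ▸ hg₀.2))
    refine Or.inr ⟨sInf G, sSup G, hkinf, (csInf_le hbb hg₀).trans_lt hg₀sup,
      Set.ext fun x => ⟨fun hx => ?_, ?_⟩⟩
    · by_contra h'
      simp only [Set.mem_union, Set.mem_Icc, Set.mem_Ici, not_or, not_and, not_le] at h'
      obtain ⟨g, hg, hxg⟩ := exists_lt_of_lt_csSup ⟨g₀, hg₀⟩ h'.2
      obtain ⟨g', hg', hxg'⟩ := exists_lt_of_csInf_lt ⟨g₀, hg₀⟩ (h'.1 hx.1)
      exact absurd hx.2 (not_le.2 (hconv.out hg' hg ⟨hxg'.le, hxg.le⟩).2)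
    · rintro (hx | hx)
      · refine ⟨hx.1, ?_⟩
        by_contra h'
        have hxG : x ∈ G := ⟨hx.1, not_le.1 h'⟩
        have : x = sInf G := le_antisymm hx.2 (csInf_le hbb hxG)
        exact h' (this ▸ hinf)
      · exact ⟨hksup.trans hx, hright x hx⟩

end PencilBounds

/-! ### Enclosures of the real region -/

namespace PencilBounds

/-- The real points `z ≤ 0` with `z² + 2 C (t - κ)^p z + t ≤ 0` for some `t ≥ κ₀`. All enclosures of
the real spectrum are enclosures of this set. -/
def realRegion (p C κ κ₀ : ℝ) : Set ℝ :=
  {z | z ≤ 0 ∧ ∃ t, κ₀ ≤ t ∧ z ^ 2 + 2 * (C * (t - κ) ^ p) * z + t ≤ 0}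

section

variable {p C κ κ₀ z : ℝ}

theorem exists_mem_D_of_mem_realRegion (hκ₀ : 0 ≤ κ₀) (hκ : κ ≤ κ₀) (hp : 0 < p) (hC : 0 < C)
    (hz : z ∈ realRegion p C κ κ₀) :
    ∃ t ∈ D p C κ κ₀, gMinus p C κ t ≤ z ∧ z ≤ gPlus p C κ t := by
  obtain ⟨-, t, ht, h⟩ := hz
  obtain ⟨h1, h2⟩ := (quadratic_nonpos_iff_mem_Icc (hκ.trans ht)).1 h
  exact ⟨t, (mem_D_iff hκ₀ hκ hp hC).2 ⟨ht, h1⟩, h2⟩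

theorem bddAbove_D (hκ₀ : 0 ≤ κ₀) (hκ : κ ≤ κ₀) (hp : 0 < p) (hC : 0 < C)
    (h : p < 1 / 2 ∨ (p = 1 / 2 ∧ C < 1) ∨ (p = 1 / 2 ∧ C = 1 ∧ 0 < κ)) :
    BddAbove (D p C κ κ₀) := by
  rcases h with h | ⟨rfl, h⟩ | ⟨rfl, rfl, h⟩
  · obtain ⟨K, -, hK⟩ := exists_mul_rpow_le (q := 2 * p) (A := C ^ 2) (δ := 1 / 2) (by positivity)
      (by linarith) (by positivity) (by norm_num)
    refine ⟨2 * K - κ, fun t ht => ?_⟩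
    obtain ⟨h1, h2⟩ := (mem_D_iff hκ₀ hκ hp hC).1 ht
    linarith [hK (t - κ) (by linarith)]
  · have hC1 : 0 < 1 - C ^ 2 := by nlinarith
    refine ⟨-(C ^ 2 * κ) / (1 - C ^ 2), fun t ht => ?_⟩
    obtain ⟨h1, h2⟩ := (mem_D_iff hκ₀ hκ hp hC).1 ht
    norm_num at h2
    rw [le_div_iff₀ hC1]
    linarith
  · refine ⟨0, fun t ht => ?_⟩
    obtain ⟨h1, h2⟩ := (mem_D_iff hκ₀ hκ hp hC).1 ht
    norm_num at h2
    linarith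

theorem realRegion_subset_of_bounded (hκ₀ : 0 ≤ κ₀) (hκ : κ ≤ κ₀) (hp : 0 < p) (hC : 0 < C)
    (h : p < 1 / 2 ∨ (p = 1 / 2 ∧ C < 1) ∨ (p = 1 / 2 ∧ C = 1 ∧ 0 < κ)) :
    (D p C κ κ₀ = ∅ ∧ realRegion p C κ κ₀ = ∅) ∨
      ∃ sm sp : ℝ,
        IsLeast (gMinus p C κ '' D p C κ κ₀) sm ∧
        IsGreatest (gPlus p C κ '' D p C κ κ₀) sp ∧
        sm ≤ sp ∧ sp ≤ 0 ∧ realRegion p C κ κ₀ ⊆ Set.Icc sm sp := by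
  rcases (D p C κ κ₀).eq_empty_or_nonempty with hD | hD
  · refine Or.inl ⟨hD, Set.eq_empty_of_forall_notMem fun z hz => ?_⟩
    obtain ⟨t, ht, -⟩ := exists_mem_D_of_mem_realRegion hκ₀ hκ hp hC hz
    simp [hD] at ht
  · have hcomp : IsCompact (D p C κ κ₀) := Metric.isCompact_of_isClosed_isBounded (isClosed_D hp)
      (isBounded_iff_bddBelow_bddAbove.2 ⟨⟨κ₀, fun t ht => ht.1⟩, bddAbove_D hκ₀ hκ hp hC h⟩)
    obtain ⟨sm, hsm⟩ := (hcomp.image (continuous_gMinus hp)).exists_isLeast (hD.image _)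
    obtain ⟨sp, hsp⟩ := (hcomp.image (continuous_gPlus hp)).exists_isGreatest (hD.image _)
    refine Or.inr ⟨sm, sp, hsm, hsp, ?_, ?_, fun z hz => ?_⟩
    · obtain ⟨t, ht⟩ := hD
      exact (hsm.2 ⟨t, ht, rfl⟩).trans (gMinus_le_gPlus.trans (hsp.2 ⟨t, ht, rfl⟩))
    · obtain ⟨t, ht, rfl⟩ := hsp.1
      exact gPlus_nonpos hC (hκ₀.trans ht.1) (hκ.trans ht.1)
    · obtain ⟨t, ht, h1, h2⟩ := exists_mem_D_of_mem_realRegion hκ₀ hκ hp hC hz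
      exact ⟨(hsm.2 ⟨t, ht, rfl⟩).trans h1, h2.trans (hsp.2 ⟨t, ht, rfl⟩)⟩

/-- In the unbounded case the radicand of `g±` is eventually nonnegative. -/
theorem eventually_le_mul_rpow (hp : 0 < p) (hp1 : p < 1) (hC : 0 < C)
    (h : 1 / 2 < p ∨ (p = 1 / 2 ∧ 1 < C) ∨ (p = 1 / 2 ∧ C = 1 ∧ κ ≤ 0)) :
    ∃ M, ∀ t, M ≤ t → κ ≤ t → t ≤ C ^ 2 * (t - κ) ^ (2 * p) := by
  rcases h with h | ⟨rfl, h⟩ | ⟨rfl, rfl, h⟩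
  · obtain ⟨K, hK0, hK⟩ := exists_mul_rpow_le (q := 1 / (2 * p)) (A := 2) (δ := C ^ 2)
      (by positivity) (by rw [div_lt_one (by positivity)]; linarith) (by norm_num) (by positivity)
    refine ⟨max 0 (K + 2 * |κ|), fun t ht htκ => ?_⟩
    have hs : 0 ≤ t - κ := by linarith
    have h1 := hK ((t - κ) ^ (2 * p)) (by positivity)
    rw [← Real.rpow_mul hs, mul_one_div_cancel (by positivity), Real.rpow_one] at h1
    have h2 := (le_max_right _ _).trans ht
    linarith [le_abs_self κ]
  · have hC1 : 0 < C ^ 2 - 1 := by nlinarith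
    refine ⟨C ^ 2 * κ / (C ^ 2 - 1), fun t ht _ => ?_⟩
    norm_num
    rw [div_le_iff₀ hC1] at ht
    linarith
  · refine ⟨0, fun t ht _ => ?_⟩
    norm_num
    linarith

/-- The concavity of `t ↦ (t - κ)^p` makes `{t | z² + 2 C (t - κ)^p z + t ≤ 0}` an interval for
each `z ≤ 0`, so the parts of the region that stem from the two components of `D` are disjoint. -/
theorem mem_D_of_mem_Icc (hκ₀ : 0 ≤ κ₀) (hκ : κ ≤ κ₀) (hp : 0 < p) (hp1 : p < 1) (hC : 0 < C)
    {t₁ t₂ t : ℝ} (hz : z ≤ 0) (ht₁ : κ₀ ≤ t₁) (ht : t ∈ Set.Icc t₁ t₂)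
    (h₁ : z ^ 2 + 2 * (C * (t₁ - κ) ^ p) * z + t₁ ≤ 0)
    (h₂ : z ^ 2 + 2 * (C * (t₂ - κ) ^ p) * z + t₂ ≤ 0) : t ∈ D p C κ κ₀ := by
  have hcv : ConvexOn ℝ (Set.Ici 0)
      fun s : ℝ => z ^ 2 + 2 * (C * s ^ p) * z + (s + κ) := by
    have e : (fun s : ℝ => z ^ 2 + 2 * (C * s ^ p) * z + (s + κ))
        = fun s => (2 * C * -z) * (-(s ^ p)) + (s + (z ^ 2 + κ)) := by ext s; ring
    rw [e]
    refine ConvexOn.add ?_ ?_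
    · have := (Real.concaveOn_rpow hp.le hp1.le).neg
      exact this.smul (mul_nonneg (by positivity) (by linarith))
    · exact (convexOn_id (convex_Ici 0)).add (convexOn_const _ (convex_Ici 0))
  have hoc := (hcv.convex_le 0).ordConnected
  have h := hoc.out (x := t₁ - κ) (y := t₂ - κ) ⟨by simp; linarith, by simpa using h₁⟩
    ⟨by simp; linarith [ht.1, ht.2], by simpa using h₂⟩
    (⟨by linarith [ht.1], by linarith [ht.2]⟩ : t - κ ∈ Set.Icc (t₁ - κ) (t₂ - κ))
  have h' : z ^ 2 + 2 * (C * (t - κ) ^ p) * z + t ≤ 0 := by simpa using h.2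
  have htk : κ₀ ≤ t := ht₁.trans ht.1
  exact (mem_D_iff hκ₀ hκ hp hC).2
    ⟨htk, ((quadratic_nonpos_iff_mem_Icc (hκ.trans htk)).1 h').1⟩

theorem realRegion_subset_of_unbounded (hκ₀ : 0 ≤ κ₀) (hκ : κ ≤ κ₀) (hp : 0 < p) (hp1 : p < 1)
    (hC : 0 < C) (h : 1 / 2 < p ∨ (p = 1 / 2 ∧ 1 < C) ∨ (p = 1 / 2 ∧ C = 1 ∧ κ ≤ 0)) :
    (∃ xm xp rp sm sp : ℝ, κ₀ ≤ xm ∧ xm < xp ∧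
        D p C κ κ₀ = Set.Icc κ₀ xm ∪ Set.Ici xp ∧
        IsGreatest (gPlus p C κ '' Set.Ici xp) rp ∧
        IsLeast (gMinus p C κ '' Set.Icc κ₀ xm) sm ∧
        IsGreatest (gPlus p C κ '' Set.Icc κ₀ xm) sp ∧
        rp < sm ∧ sm ≤ sp ∧ sp ≤ 0 ∧
        realRegion p C κ κ₀ ⊆ Set.Iic rp ∪ Set.Icc sm sp) ∨
      (∃ x sp : ℝ, κ₀ ≤ x ∧ D p C κ κ₀ = Set.Ici x ∧
        IsGreatest (gPlus p C κ '' Set.Ici x) sp ∧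
        sp ≤ 0 ∧ realRegion p C κ κ₀ ⊆ Set.Iic sp) := by
  obtain ⟨M, hM⟩ := eventually_le_mul_rpow (κ := κ) hp hp1 hC h
  have htend : Tendsto (gPlus p C κ) atTop atBot := tendsto_gPlus hp hp1 hC (by
    filter_upwards [eventually_ge_atTop M, eventually_ge_atTop κ] with t h1 h2 using hM t h1 h2)
  have hp2 : 1 / 2 ≤ p := by
    rcases h with h | h | h
    exacts [h.le, h.1.ge, h.1.ge]
  have hd : Continuous fun x : ℝ => C ^ (-1 / p) * x ^ (1 / (2 * p)) - x + κ :=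
    ((continuous_const.mul (continuous_id.rpow_const fun _ => Or.inr (by positivity))).sub
      continuous_id).add continuous_const
  have hcv : ConcaveOn ℝ (Set.Ici κ₀)
      fun x : ℝ => C ^ (-1 / p) * x ^ (1 / (2 * p)) - x + κ := by
    have h1 : ConcaveOn ℝ (Set.Ici 0) fun x : ℝ => x ^ (1 / (2 * p)) :=
      Real.concaveOn_rpow (by positivity) (by rw [div_le_one (by positivity)]; linarith)
    have h2 := h1.smul (Real.rpow_nonneg hC.le (-1 / p))
    have h3 := (h2.sub (convexOn_id (convex_Ici 0))).add (concaveOn_const κ (convex_Ici 0))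
    exact h3.subset (Set.Ici_subset_Ici.2 hκ₀) (convex_Ici _)
  have hM' : ∀ x, max M κ₀ ≤ x → C ^ (-1 / p) * x ^ (1 / (2 * p)) - x + κ ≤ 0 := fun x hx => by
    have hx0 : κ₀ ≤ x := (le_max_right _ _).trans hx
    exact ((mem_D_iff hκ₀ hκ hp hC).2
      ⟨hx0, hM x ((le_max_left _ _).trans hx) (hκ.trans hx0)⟩).2
  rcases sublevel_eq_of_concaveOn hd hcv hM' with ⟨x, hx, hDx⟩ | ⟨xm, xp, h1, h2, hDx⟩
  · right
    replace hDx : D p C κ κ₀ = Set.Ici x := hDx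
    obtain ⟨sp, hsp⟩ := exists_isGreatest_image_Ici (continuous_gPlus hp) htend x
    refine ⟨x, sp, hx, hDx, hsp, ?_, fun z hz => ?_⟩
    · obtain ⟨t, ht, rfl⟩ := hsp.1
      have ht' : κ₀ ≤ t := hx.trans ht
      exact gPlus_nonpos hC (hκ₀.trans ht') (hκ.trans ht')
    · obtain ⟨t, ht, -, h3⟩ := exists_mem_D_of_mem_realRegion hκ₀ hκ hp hC hz
      rw [hDx] at ht
      exact h3.trans (hsp.2 ⟨t, ht, rfl⟩)
  · left
    replace hDx : D p C κ κ₀ = Set.Icc κ₀ xm ∪ Set.Ici xp := hDx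
    obtain ⟨rp, hrp⟩ := exists_isGreatest_image_Ici (continuous_gPlus hp) htend xp
    have hne : (Set.Icc κ₀ xm).Nonempty := Set.nonempty_Icc.2 h1
    obtain ⟨sm, hsm⟩ :=
      (isCompact_Icc.image (continuous_gMinus (C := C) (κ := κ) hp)).exists_isLeast (hne.image _)
    obtain ⟨sp, hsp⟩ :=
      (isCompact_Icc.image (continuous_gPlus (C := C) (κ := κ) hp)).exists_isGreatest (hne.image _)
    have hle : sm ≤ sp := by
      obtain ⟨t, ht⟩ := hne
      exact (hsm.2 ⟨t, ht, rfl⟩).trans (gMinus_le_gPlus.trans (hsp.2 ⟨t, ht, rfl⟩))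
    have hsp0 : sp ≤ 0 := by
      obtain ⟨t, ht, rfl⟩ := hsp.1
      exact gPlus_nonpos hC (hκ₀.trans ht.1) (hκ.trans ht.1)
    have mem_roots : ∀ t ∈ D p C κ κ₀, ∀ z, gMinus p C κ t ≤ z → z ≤ gPlus p C κ t →
        z ^ 2 + 2 * (C * (t - κ) ^ p) * z + t ≤ 0 := fun t ht z h3 h4 =>
      (quadratic_nonpos_iff_mem_Icc (hκ.trans ht.1)).2
        ⟨((mem_D_iff hκ₀ hκ hp hC).1 ht).2, h3, h4⟩
    refine ⟨xm, xp, rp, sm, sp, h1, h2, hDx, hrp, hsm, hsp, ?_, hle, hsp0, fun z hz => ?_⟩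
    · by_contra hcon
      obtain ⟨t₁, ht₁, hrpe⟩ := hrp.1
      obtain ⟨t₂, ht₂, hsme⟩ := hsm.1
      -- as `g₊ → -∞`, it attains the value `sm` to the right of the gap as well
      obtain ⟨N, hN⟩ := eventually_atTop.1 (htend.eventually_le_atBot sm)
      obtain ⟨t₃, ht₃, ht₃e⟩ : sm ∈ gPlus p C κ '' Set.Icc t₁ (max t₁ N) :=
        intermediate_value_Icc' (le_max_left _ _) (continuous_gPlus hp).continuousOn
          ⟨hN _ (le_max_right _ _), by rw [hrpe]; exact not_lt.1 hcon⟩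
      have hxp3 : xp ≤ t₃ := le_trans ht₁ ht₃.1
      have ht₂D : t₂ ∈ D p C κ κ₀ := hDx ▸ Or.inl ht₂
      have ht₃D : t₃ ∈ D p C κ κ₀ := hDx ▸ Or.inr hxp3
      have hmid := mem_D_of_mem_Icc (t := (xm + xp) / 2) hκ₀ hκ hp hp1 hC (hle.trans hsp0) ht₂.1
        ⟨by linarith [ht₂.2], by linarith⟩
        (mem_roots t₂ ht₂D sm hsme.le (hsme ▸ gMinus_le_gPlus))
        (mem_roots t₃ ht₃D sm (ht₃e ▸ gMinus_le_gPlus) ht₃e.ge)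
      rw [hDx] at hmid
      rcases hmid with hmid | hmid
      · linarith [hmid.2]
      · linarith [Set.mem_Ici.1 hmid]
    · obtain ⟨t, ht, h3, h4⟩ := exists_mem_D_of_mem_realRegion hκ₀ hκ hp hC hz
      rw [hDx] at ht
      rcases ht with ht | ht
      · exact Or.inr ⟨(hsm.2 ⟨t, ht, rfl⟩).trans h3, h4.trans (hsp.2 ⟨t, ht, rfl⟩)⟩
      · exact Or.inl (h4.trans (hrp.2 ⟨t, ht, rfl⟩))

end

end PencilBounds

/-! ### Explicit bounds for `κ = 0` -/

namespace PencilBounds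

section

variable {p C κ₀ z : ℝ}

/-- The unconstrained extremal point of `g±` for `κ = 0`, where `t^(1 - 2p) = 4 C² p (1 - p)`. -/
noncomputable def tStar (p C : ℝ) : ℝ := (4 * C ^ 2 * p * (1 - p)) ^ (-1 / (2 * p - 1))

theorem tStar_pos (hp0 : 0 < p) (hp1 : p < 1) (hC : 0 < C) : 0 < tStar p C := by
  have : 0 < 1 - p := by linarith
  exact Real.rpow_pos_of_pos (by positivity) _

theorem tStar_rpow (hp0 : 0 < p) (hp1 : p < 1) (hC : 0 < C) (h : p ≠ 1 / 2) :
    tStar p C ^ (1 - 2 * p) = 4 * C ^ 2 * p * (1 - p) := by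
  have h1 : 0 < 1 - p := by linarith
  have h2 : 2 * p - 1 ≠ 0 := fun h' => h (by linarith)
  rw [tStar, ← Real.rpow_mul (by positivity),
    show -1 / (2 * p - 1) * (1 - 2 * p) = 1 by field_simp; ring, Real.rpow_one]

theorem eq_mul_rpow_mul_rpow {t : ℝ} (ht : 0 < t) (p : ℝ) :
    t = t ^ (1 - 2 * p) * (t ^ p) ^ 2 := by
  rw [← Real.rpow_natCast, ← Real.rpow_mul ht.le, ← Real.rpow_add ht]
  norm_num
  rw [show 1 - 2 * p + p * 2 = 1 by ring, Real.rpow_one]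

theorem tStar_eq (hp0 : 0 < p) (hp1 : p < 1) (hC : 0 < C) (h : p ≠ 1 / 2) :
    tStar p C = 4 * p * (1 - p) * (C * tStar p C ^ p) ^ 2 := by
  conv_lhs => rw [eq_mul_rpow_mul_rpow (tStar_pos hp0 hp1 hC) p, tStar_rpow hp0 hp1 hC h]
  ring

theorem sqrt_tStar (hp0 : 0 < p) (hp1 : p < 1) (hC : 0 < C) (h : p ≠ 1 / 2) :
    √(C ^ 2 * tStar p C ^ (2 * p) - tStar p C) = |1 - 2 * p| * (C * tStar p C ^ p) := by
  have h0 := tStar_pos hp0 hp1 hC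
  have h1 : 0 ≤ C * tStar p C ^ p := by positivity
  rw [← sq_mul_rpow h0.le]
  have h2 : (C * tStar p C ^ p) ^ 2 - tStar p C = ((1 - 2 * p) * (C * tStar p C ^ p)) ^ 2 := by
    have := tStar_eq hp0 hp1 hC h
    linear_combination -this
  rw [h2, Real.sqrt_sq_eq_abs, abs_mul, abs_of_nonneg h1]

/-- Scaling by the extremal pair `(r, t) = (2 (1 - p) C t⋆^p, t⋆)` turns `r² + t ≤ 2 C t^p r` into
`(1 - p) x² + p y ≤ x y^p`, and the weighted inequality between the arithmetic and the geometric
mean then bounds `x`. -/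
theorem rpow_le_of_quadratic_nonpos (hp0 : 0 < p) (hp1 : p < 1) (hC : 0 < C) (h : p ≠ 1 / 2)
    {r t : ℝ} (hr : 0 < r) (ht : 0 < t) (hrt : r ^ 2 + t ≤ 2 * (C * t ^ p) * r) :
    (r / (2 * (1 - p) * (C * tStar p C ^ p))) ^ (2 * (1 - p))
      ≤ r / (2 * (1 - p) * (C * tStar p C ^ p)) := by
  have hq : 0 < 1 - p := by linarith
  have h0 := tStar_pos hp0 hp1 hC
  have hm := tStar_eq hp0 hp1 hC h
  have hw : 0 < C * tStar p C ^ p := by positivity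
  set τ := tStar p C
  set w := C * τ ^ p with hwdef
  set x := r / (2 * (1 - p) * w) with hx
  set y := t / τ with hy
  have hx0 : 0 < x := by positivity
  have hy0 : 0 < y := by positivity
  have er : r = 2 * (1 - p) * w * x := by rw [hx]; field_simp
  have et : t = y * τ := by rw [hy]; field_simp
  have etp : C * t ^ p = w * y ^ p := by rw [et, Real.mul_rpow hy0.le h0.le, hwdef]; ring
  rw [etp, er, et, hm] at hrt
  have h3 : (1 - p) * x ^ 2 + p * y ≤ x * y ^ p := by
    have h4 : (4 * (1 - p) * w ^ 2) * ((1 - p) * x ^ 2 + p * y)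
        ≤ (4 * (1 - p) * w ^ 2) * (x * y ^ p) := by linarith
    exact le_of_mul_le_mul_left h4 (by positivity)
  have h5 := Real.geom_mean_le_arith_mean2_weighted hq.le hp0.le (sq_nonneg x) hy0.le (by ring)
  rw [← Real.rpow_natCast, ← Real.rpow_mul hx0.le] at h5
  have hyp : 0 < y ^ p := Real.rpow_pos_of_pos hy0 _
  have h6 : x ^ (2 * (1 - p)) * y ^ p ≤ x * y ^ p := by
    refine le_trans ?_ h3
    exact_mod_cast h5
  exact le_of_mul_le_mul_right h6 hyp

theorem le_of_quadratic_nonpos (hp0 : 0 < p) (hp1 : p < 1 / 2) (hC : 0 < C)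
    {r t : ℝ} (hr : 0 < r) (ht : 0 < t) (hrt : r ^ 2 + t ≤ 2 * (C * t ^ p) * r) :
    r ≤ 2 * (1 - p) * (C * tStar p C ^ p) := by
  have h := rpow_le_of_quadratic_nonpos hp0 (by linarith) hC hp1.ne hr ht hrt
  have hq : 0 < 1 - p := by linarith
  have hw : 0 < 2 * (1 - p) * (C * tStar p C ^ p) := by
    have := tStar_pos hp0 (by linarith) hC
    positivity
  by_contra h'
  have h1 : 1 < r / (2 * (1 - p) * (C * tStar p C ^ p)) := by
    rw [one_lt_div hw]; exact not_le.1 h'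
  have := Real.rpow_lt_rpow_of_exponent_lt h1 (show 1 < 2 * (1 - p) by linarith)
  rw [Real.rpow_one] at this
  linarith

theorem ge_of_quadratic_nonpos (hp0 : 1 / 2 < p) (hp1 : p < 1) (hC : 0 < C)
    {r t : ℝ} (hr : 0 < r) (ht : 0 < t) (hrt : r ^ 2 + t ≤ 2 * (C * t ^ p) * r) :
    2 * (1 - p) * (C * tStar p C ^ p) ≤ r := by
  have h := rpow_le_of_quadratic_nonpos (by linarith) hp1 hC hp0.ne' hr ht hrt
  have hq : 0 < 1 - p := by linarith
  have hw : 0 < 2 * (1 - p) * (C * tStar p C ^ p) := by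
    have := tStar_pos (by linarith) hp1 hC
    positivity
  by_contra h'
  have h1 : r / (2 * (1 - p) * (C * tStar p C ^ p)) < 1 := by
    rw [div_lt_one hw]; exact not_le.1 h'
  have := Real.rpow_lt_rpow_of_exponent_gt (by positivity) h1 (show 2 * (1 - p) < 1 by linarith)
  rw [Real.rpow_one] at this
  linarith

/-- If the tangent at `k` of the convex function `t ↦ r² + t - 2 C t^p r` does not decrease, then
nonpositivity is inherited from `t ≥ k` to `k`. -/
theorem quadratic_nonpos_of_tangent (hp0 : 0 < p) (hp1 : p < 1) (hC : 0 < C)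
    {r t k : ℝ} (hr : 0 ≤ r) (hk : 0 < k) (hkt : k ≤ t)
    (hrt : r ^ 2 + t ≤ 2 * (C * t ^ p) * r) (hslope : 2 * p * (C * k ^ p) * r ≤ k) :
    r ^ 2 + k ≤ 2 * (C * k ^ p) * r := by
  have hkp : 0 < k ^ p := Real.rpow_pos_of_pos hk _
  have h1 : (t / k) ^ p ≤ 1 + p * (t / k - 1) := by
    have := rpow_one_add_le_one_add_mul_self (s := t / k - 1)
      (by linarith [show 0 ≤ t / k by have := hk.trans_le hkt; positivity]) hp0.le hp1.le
    simpa using this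
  have h2 : t ^ p = k ^ p * (t / k) ^ p := by
    rw [← Real.mul_rpow hk.le (by have := hk.trans_le hkt; positivity), mul_div_cancel₀ _ hk.ne']
  have h3 : 2 * (C * t ^ p) * r ≤ 2 * (C * k ^ p) * r * (1 + p * (t / k - 1)) := by
    rw [h2]
    have : 0 ≤ 2 * (C * k ^ p) * r := by positivity
    nlinarith [mul_le_mul_of_nonneg_left h1 this]
  have h4 : 2 * p * (C * k ^ p) * r * (t / k - 1) ≤ k * (t / k - 1) :=
    mul_le_mul_of_nonneg_right hslope (by rw [sub_nonneg, one_le_div hk]; exact hkt)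
  have h5 : k * (t / k - 1) = t - k := by field_simp
  nlinarith

theorem exists_pos_of_mem_realRegion (hκ₀ : 0 ≤ κ₀) (hp : 0 < p)
    (hz : z ∈ realRegion p C 0 κ₀) (hz0 : z ≠ 0) :
    ∃ t, 0 < t ∧ κ₀ ≤ t ∧ (-z) ^ 2 + t ≤ 2 * (C * t ^ p) * (-z) := by
  obtain ⟨-, t, ht, h⟩ := hz
  rw [sub_zero] at h
  refine ⟨t, lt_of_le_of_ne (hκ₀.trans ht) ?_, ht, by linarith⟩
  rintro rfl
  rw [Real.zero_rpow hp.ne'] at h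
  exact hz0 (pow_eq_zero_iff two_ne_zero |>.1 (le_antisymm (by linarith) (sq_nonneg z)))

/-- For `κ = 0` and `p ≤ 1/2` the function `g₊` is antitone on `D`. -/
theorem le_gPlus_of_mem_realRegion (hκ₀ : 0 ≤ κ₀) (hp0 : 0 < p) (hp1 : p ≤ 1 / 2)
    (hz : z ∈ realRegion p C 0 κ₀) : z ≤ -(C * κ₀ ^ p) + √(C ^ 2 * κ₀ ^ (2 * p) - κ₀) := by
  rcases hκ₀.eq_or_lt with rfl | hk
  · rw [Real.zero_rpow hp0.ne', Real.zero_rpow (by positivity)]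
    simpa using hz.1
  rcases eq_or_ne z 0 with rfl | hz0
  · obtain ⟨-, t, ht, h⟩ := hz
    norm_num at h
    linarith
  obtain ⟨t, ht0, ht, h⟩ := exists_pos_of_mem_realRegion hκ₀ hp0 hz hz0
  have hkp : 0 < κ₀ ^ p := Real.rpow_pos_of_pos hk _
  have htp : 0 < t ^ p := Real.rpow_pos_of_pos ht0 _
  have hr : 0 < -z := by
    have := lt_of_le_of_ne hz.1 hz0
    linarith
  set u := -z / t ^ p with hu
  have hu0 : 0 < u := by positivity
  have er : -z = u * t ^ p := by rw [hu]; field_simp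
  have h1 : u ^ 2 + t ^ (1 - 2 * p) ≤ 2 * C * u := by
    have e := eq_mul_rpow_mul_rpow ht0 p
    rw [er] at h
    have h2 : (t ^ p) ^ 2 * (u ^ 2 + t ^ (1 - 2 * p)) ≤ (t ^ p) ^ 2 * (2 * C * u) := by
      linarith
    exact le_of_mul_le_mul_left h2 (by positivity)
  have h2 : κ₀ ^ (1 - 2 * p) ≤ t ^ (1 - 2 * p) := Real.rpow_le_rpow hk.le ht (by linarith)
  have h3 : (-(u * κ₀ ^ p)) ^ 2 + 2 * (C * (κ₀ - 0) ^ p) * (-(u * κ₀ ^ p)) + κ₀ ≤ 0 := by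
    have e := eq_mul_rpow_mul_rpow hk p
    rw [sub_zero]
    have h4 : (κ₀ ^ p) ^ 2 * (u ^ 2 + κ₀ ^ (1 - 2 * p)) ≤ (κ₀ ^ p) ^ 2 * (2 * C * u) :=
      mul_le_mul_of_nonneg_left (by linarith) (by positivity)
    linarith
  have h5 := ((quadratic_nonpos_iff_mem_Icc hk.le).1 h3).2.2
  rw [gPlus, sub_zero] at h5
  have h6 : u * κ₀ ^ p ≤ u * t ^ p :=
    mul_le_mul_of_nonneg_left (Real.rpow_le_rpow hk.le ht hp0.le) hu0.le
  linarith

theorem gMinus_tZero_le_of_mem_realRegion (hκ₀ : 0 ≤ κ₀) (hp0 : 0 < p) (hp1 : p < 1 / 2)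
    (hC : 0 < C) (hz : z ∈ realRegion p C 0 κ₀) :
    -(C * tZero p C κ₀ ^ p) - √(C ^ 2 * tZero p C κ₀ ^ (2 * p) - tZero p C κ₀) ≤ z := by
  have hτ := tStar_pos hp0 (by linarith) hC
  have hT : tZero p C κ₀ = max (tStar p C) κ₀ := rfl
  have hT0 : 0 < tZero p C κ₀ := hT ▸ lt_max_of_lt_left hτ
  rcases eq_or_ne z 0 with rfl | hz0
  · have : 0 ≤ C * tZero p C κ₀ ^ p := by positivity
    linarith [Real.sqrt_nonneg (C ^ 2 * tZero p C κ₀ ^ (2 * p) - tZero p C κ₀)]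
  obtain ⟨t, ht0, ht, h⟩ := exists_pos_of_mem_realRegion hκ₀ hp0 hz hz0
  have hr : 0 < -z := by
    have := lt_of_le_of_ne hz.1 hz0
    linarith
  have hb := le_of_quadratic_nonpos hp0 hp1 hC hr ht0 h
  rcases le_total κ₀ (tStar p C) with hc | hc
  · rw [hT, max_eq_left hc, sqrt_tStar hp0 (by linarith) hC hp1.ne,
      abs_of_pos (by linarith)]
    linarith
  · rw [hT, max_eq_right hc]
    have hk : 0 < κ₀ := hτ.trans_le hc
    have hkp : 0 < κ₀ ^ p := Real.rpow_pos_of_pos hk _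
    have hτp : 0 < tStar p C ^ p := Real.rpow_pos_of_pos hτ _
    -- `t⋆ = 4 p (1 - p) C² (t⋆^p)²` and `t⋆ ≤ κ₀` bound the slope at `κ₀`
    have hslope : 2 * p * (C * κ₀ ^ p) * -z ≤ κ₀ := by
      have e := tStar_eq hp0 (by linarith) hC hp1.ne
      have e1 : tStar p C ^ p * tStar p C ^ (1 - p) = tStar p C := by
        rw [← Real.rpow_add hτ]; simp
      have e2 : κ₀ ^ p * κ₀ ^ (1 - p) = κ₀ := by rw [← Real.rpow_add hk]; simp
      have h1 : tStar p C ^ (1 - p) ≤ κ₀ ^ (1 - p) := Real.rpow_le_rpow hτ.le hc (by linarith)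
      have h2 : 2 * p * C * (2 * (1 - p) * (C * tStar p C ^ p)) = tStar p C ^ (1 - p) := by
        refine mul_left_cancel₀ hτp.ne' ?_
        rw [e1]; linarith
      calc 2 * p * (C * κ₀ ^ p) * -z = κ₀ ^ p * (2 * p * C * -z) := by ring
        _ ≤ κ₀ ^ p * (2 * p * C * (2 * (1 - p) * (C * tStar p C ^ p))) := by gcongr
        _ ≤ κ₀ ^ p * κ₀ ^ (1 - p) := by rw [h2]; gcongr
        _ = κ₀ := e2
    have h3 := quadratic_nonpos_of_tangent hp0 (by linarith) hC hr.le hk ht h hslope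
    have h4 : z ^ 2 + 2 * (C * (κ₀ - 0) ^ p) * z + κ₀ ≤ 0 := by rw [sub_zero]; linarith
    have h5 := ((quadratic_nonpos_iff_mem_Icc hk.le).1 h4).2.1
    rwa [gMinus, sub_zero] at h5

theorem realRegion_eq_empty (hκ₀ : 0 ≤ κ₀) (hp0 : 0 < p) (hp1 : p < 1 / 2) (hC : 0 < C)
    (h : (C ^ 2) ^ (1 / (1 - 2 * p)) < κ₀) : realRegion p C 0 κ₀ = ∅ := by
  refine Set.eq_empty_of_forall_notMem fun z hz => ?_
  obtain ⟨t, ht, -⟩ := exists_mem_D_of_mem_realRegion hκ₀ hκ₀ hp0 hC hz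
  obtain ⟨h1, h2⟩ := (mem_D_iff hκ₀ hκ₀ hp0 hC).1 ht
  rw [sub_zero] at h2
  have ht0 : 0 < t := (Real.rpow_pos_of_pos (by positivity) _).trans (h.trans_le h1)
  have h3 : t ^ (1 - 2 * p) ≤ C ^ 2 := by
    have h4 : t ^ (1 - 2 * p) * t ^ (2 * p) = t := by rw [← Real.rpow_add ht0]; simp
    have h5 : 0 < t ^ (2 * p) := Real.rpow_pos_of_pos ht0 _
    exact le_of_mul_le_mul_right (by linarith) h5
  have h6 := (Real.le_rpow_inv_iff_of_pos ht0.le (by positivity) (by linarith)).2 h3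
  rw [one_div] at h
  linarith

theorem realRegion_half_subset (hκ₀ : 0 ≤ κ₀) (hC : 0 < C) (hC1 : C < 1) :
    (0 < κ₀ → realRegion (1 / 2) C 0 κ₀ = ∅) ∧ realRegion (1 / 2) C 0 κ₀ ⊆ {0} := by
  have key : ∀ z ∈ realRegion (1 / 2) C 0 κ₀, κ₀ = 0 ∧ z = 0 := by
    rintro z ⟨-, t, ht, h⟩
    have ht0 : 0 ≤ t := hκ₀.trans ht
    rw [sub_zero, ← Real.sqrt_eq_rpow] at h
    have hs := Real.sq_sqrt ht0
    have h1 : (z + C * √t) ^ 2 + (1 - C ^ 2) * t ≤ 0 := by nlinarith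
    have hC2 : 0 < 1 - C ^ 2 := by nlinarith
    have h2 : (1 - C ^ 2) * t ≤ 0 := by nlinarith [sq_nonneg (z + C * √t)]
    have h3 : t ≤ 0 := by
      by_contra h'
      exact absurd h2 (not_le.2 (mul_pos hC2 (not_le.1 h')))
    have h4 : t = 0 := le_antisymm h3 ht0
    subst h4
    refine ⟨le_antisymm ht hκ₀, ?_⟩
    simp only [Real.sqrt_zero, mul_zero, zero_mul, add_zero] at h
    exact pow_eq_zero_iff two_ne_zero |>.1 (le_antisymm h (sq_nonneg z))
  exact ⟨fun h => Set.eq_empty_of_forall_notMem fun z hz => h.ne' (key z hz).1,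
    fun z hz => (key z hz).2⟩

theorem realRegion_half_subset_Iic (hκ₀ : 0 ≤ κ₀) :
    realRegion (1 / 2) C 0 κ₀ ⊆ Set.Iic (-((C - √(C ^ 2 - 1)) * κ₀ ^ (1 / 2 : ℝ))) := by
  intro z hz
  have h := le_gPlus_of_mem_realRegion hκ₀ (by norm_num) le_rfl hz
  have e : √(C ^ 2 * κ₀ ^ (2 * (1 / 2) : ℝ) - κ₀) = √(C ^ 2 - 1) * κ₀ ^ (1 / 2 : ℝ) := by
    rw [← Real.sqrt_eq_rpow, ← Real.sqrt_mul' _ hκ₀]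
    norm_num
    congr 1
    ring
  rw [e] at h
  refine Set.mem_Iic.2 ?_
  linarith

theorem le_gPlus_tZero_of_mem_realRegion (hκ₀ : 0 ≤ κ₀) (hp0 : 1 / 2 < p) (hp1 : p < 1)
    (hC : 0 < C) (hz : z ∈ realRegion p C 0 κ₀) (hz0 : z ≠ 0) :
    z ≤ -(C * tZero p C κ₀ ^ p) + √(C ^ 2 * tZero p C κ₀ ^ (2 * p) - tZero p C κ₀) := by
  have hp : 0 < p := by linarith
  have hq : 0 < 1 - p := by linarith
  have hτ := tStar_pos hp hp1 hC
  have hT : tZero p C κ₀ = max (tStar p C) κ₀ := rfl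
  obtain ⟨t, ht0, ht, h⟩ := exists_pos_of_mem_realRegion hκ₀ hp hz hz0
  have hr : 0 < -z := by
    have := lt_of_le_of_ne hz.1 hz0
    linarith
  rcases le_total κ₀ (tStar p C) with hc | hc
  · have hb := ge_of_quadratic_nonpos hp0 hp1 hC hr ht0 h
    rw [hT, max_eq_left hc, sqrt_tStar hp hp1 hC hp0.ne', abs_of_neg (by linarith)]
    linarith
  · rw [hT, max_eq_right hc]
    have hk : 0 < κ₀ := hτ.trans_le hc
    have hkp : 0 < κ₀ ^ p := Real.rpow_pos_of_pos hk _
    have e := eq_mul_rpow_mul_rpow hk p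
    have h1 : κ₀ ^ (1 - 2 * p) ≤ 4 * C ^ 2 * p * (1 - p) := by
      rw [← tStar_rpow hp hp1 hC hp0.ne']
      exact Real.rpow_le_rpow_of_nonpos hτ hc (by linarith)
    have h2 : κ₀ ≤ 4 * p * (1 - p) * (C * κ₀ ^ p) ^ 2 := by
      have := mul_le_mul_of_nonneg_right h1 (sq_nonneg (κ₀ ^ p))
      rw [← e] at this
      linarith
    rw [← sq_mul_rpow hk.le]
    by_contra hcon
    have hw : 0 < C * κ₀ ^ p := by positivity
    set w := C * κ₀ ^ p with hwdef
    have h3 : (2 * p - 1) * w ≤ √(w ^ 2 - κ₀) := by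
      refine Real.le_sqrt_of_sq_le ?_
      nlinarith
    have h4 : √(w ^ 2 - κ₀) ^ 2 = w ^ 2 - κ₀ := Real.sq_sqrt (by nlinarith [sq_nonneg (2 * p - 1)])
    set σ := √(w ^ 2 - κ₀) with hσ
    have h5 : -z < w - σ := by linarith
    -- the smaller root `ρ = w - σ` at `κ₀` satisfies `ρ (w + σ) = κ₀` and `w + σ ≥ 2 p w`
    have h6 : 2 * p * w * -z ≤ κ₀ := by
      have h7 : 2 * p * w * -z ≤ (w + σ) * -z := mul_le_mul_of_nonneg_right (by linarith) hr.le
      have h8 : (w + σ) * -z ≤ (w + σ) * (w - σ) :=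
        mul_le_mul_of_nonneg_left h5.le (by positivity)
      nlinarith
    have h9 := quadratic_nonpos_of_tangent hp hp1 hC hr.le hk ht h h6
    have h10 := (quadratic_nonpos_iff (b := w) (t := κ₀) (z := z)).1 (by linarith)
    exact hcon h10.2.2

end

end PencilBounds

/-! ### Approximate zeros of scalar quadratics -/

namespace PencilBounds

/-- Points of the pseudo numerical range are limits of zeros of the scalar quadratics
`τ + 2 l α + l²`, where `(τ, α)` are the values of the two forms on unit vectors. -/
def IsApproxZero (p C κ κ₀ α₀ : ℝ) (l : ℂ) : Prop :=
  ∀ ε : ℝ, 0 < ε → ∃ τ α : ℝ, κ₀ ≤ τ ∧ α₀ ≤ α ∧ α ≤ C * (τ - κ) ^ p ∧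
    ‖(τ : ℂ) + 2 * l * α + l ^ 2‖ < ε

section

variable {p C κ κ₀ α₀ : ℝ} {l : ℂ}

theorem quadratic_re (τ α : ℝ) (l : ℂ) :
    ((τ : ℂ) + 2 * l * α + l ^ 2).re = τ + 2 * l.re * α + (l.re ^ 2 - l.im ^ 2) := by
  simp [pow_two]

theorem quadratic_im (τ α : ℝ) (l : ℂ) :
    ((τ : ℂ) + 2 * l * α + l ^ 2).im = 2 * l.im * (α + l.re) := by
  simp [pow_two]; ring

/-- At a nonreal approximate zero the imaginary part forces `α → -Re l`, and then the real part
forces `τ → |l|²`. -/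
theorem IsApproxZero.nonreal (hp0 : 0 < p) (h : IsApproxZero p C κ κ₀ α₀ l)
    (hl : l.im ≠ 0) :
    κ₀ ≤ l.re ^ 2 + l.im ^ 2 ∧ α₀ ≤ -l.re ∧
      -l.re ≤ C * (l.re ^ 2 + l.im ^ 2 - κ) ^ p := by
  choose τ α hτ hα hαC hn using fun n : ℕ => h (1 / ((n : ℝ) + 1)) (by positivity)
  have h0 : Tendsto (fun n => (τ n : ℂ) + 2 * l * α n + l ^ 2) atTop (𝓝 0) :=
    squeeze_zero_norm (fun n => (hn n).le) tendsto_one_div_add_atTop_nhds_zero_nat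
  have him : Tendsto (fun n => 2 * l.im * (α n + l.re)) atTop (𝓝 0) := by
    have := (Complex.continuous_im.tendsto 0).comp h0
    simpa only [Function.comp_def, quadratic_im, Complex.zero_im] using this
  have hre : Tendsto (fun n => τ n + 2 * l.re * α n + (l.re ^ 2 - l.im ^ 2)) atTop (𝓝 0) := by
    have := (Complex.continuous_re.tendsto 0).comp h0
    simpa only [Function.comp_def, quadratic_re, Complex.zero_re] using this
  have hαt : Tendsto α atTop (𝓝 (-l.re)) := by
    have := (him.const_mul (2 * l.im)⁻¹).sub_const l.re
    rw [mul_zero, zero_sub] at this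
    refine this.congr fun n => ?_
    field_simp
    ring
  have hτt : Tendsto τ atTop (𝓝 (l.re ^ 2 + l.im ^ 2)) := by
    have := (hre.sub (hαt.const_mul (2 * l.re))).sub_const (l.re ^ 2 - l.im ^ 2)
    rw [show 0 - 2 * l.re * -l.re - (l.re ^ 2 - l.im ^ 2) = l.re ^ 2 + l.im ^ 2 by ring] at this
    refine this.congr fun n => ?_
    ring
  refine ⟨ge_of_tendsto' hτt hτ, ge_of_tendsto' hαt hα, le_of_tendsto_of_tendsto' hαt ?_ hαC⟩
  exact (((continuous_sub_rpow κ hp0.le).tendsto _).comp hτt).const_mul C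

theorem IsApproxZero.re_nonpos (hκ₀ : 0 ≤ κ₀) (hα₀ : 0 ≤ α₀) (hp0 : 0 < p)
    (h : IsApproxZero p C κ κ₀ α₀ l) : l.re ≤ 0 := by
  rcases ne_or_eq l.im 0 with hl | hl
  · linarith [(h.nonreal hp0 hl).2.1]
  · by_contra hcon
    have hpos : 0 < l.re := not_le.1 hcon
    obtain ⟨τ, α, h1, h2, -, h4⟩ := h (l.re ^ 2) (by positivity)
    have h5 := (le_abs_self _).trans (Complex.abs_re_le_norm ((τ : ℂ) + 2 * l * α + l ^ 2))
    rw [quadratic_re, hl] at h5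
    have : 0 ≤ 2 * l.re * α := by have := hα₀.trans h2; positivity
    nlinarith

theorem IsApproxZero.nonreal_bounds (hα₀ : 0 ≤ α₀) (hκ : κ ≤ κ₀) (hp0 : 0 < p)
    (hC : 0 < C) (h : IsApproxZero p C κ κ₀ α₀ l) (hl : l.im ≠ 0) :
    l.re ≤ -α₀ ∧ √κ₀ ≤ ‖l‖ ∧
      √(max 0 (C ^ (-1 / p) * |l.re| ^ (1 / p) - |l.re| ^ 2 + κ)) ≤ |l.im| := by
  obtain ⟨h1, h2, h3⟩ := h.nonreal hp0 hl
  refine ⟨by linarith, ?_, ?_⟩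
  · have : ‖l‖ ^ 2 = l.re ^ 2 + l.im ^ 2 := by
      rw [← Complex.normSq_eq_norm_sq, Complex.normSq_apply]; ring
    exact Real.sqrt_le_iff.2 ⟨norm_nonneg _, by linarith⟩
  · have hs : 0 ≤ l.re ^ 2 + l.im ^ 2 - κ := by linarith
    have habs : |l.re| = -l.re := abs_of_nonpos (by linarith)
    have h4 : C ^ (-1 / p) * |l.re| ^ (1 / p) ≤ l.re ^ 2 + l.im ^ 2 - κ := by
      rw [habs]
      have h5 : -l.re / C ≤ (l.re ^ 2 + l.im ^ 2 - κ) ^ p := by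
        rw [div_le_iff₀ hC]; linarith
      have h6 : 0 ≤ -l.re / C := div_nonneg (by linarith) hC.le
      have h7 := (Real.rpow_inv_le_iff_of_pos h6 hs hp0).2 h5
      rw [Real.div_rpow (by linarith) hC.le] at h7
      rw [neg_div, Real.rpow_neg hC.le, one_div, inv_mul_eq_div]
      exact h7
    rw [Real.sqrt_le_left (abs_nonneg _), sq_abs]
    refine max_le (sq_nonneg _) ?_
    rw [sq_abs]
    linarith

/-- For real `l` the values `τ` stay bounded because `p < 1`; compactness then yields an exact
`t`. -/
theorem IsApproxZero.mem_realRegion (hκ₀ : 0 ≤ κ₀) (hα₀ : 0 ≤ α₀) (hκ : κ ≤ κ₀) (hp0 : 0 < p)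
    (hp1 : p < 1) (hC : 0 < C) {x : ℝ} (h : IsApproxZero p C κ κ₀ α₀ (x : ℂ)) :
    x ∈ realRegion p C κ κ₀ := by
  have hx : x ≤ 0 := by simpa using h.re_nonpos hκ₀ hα₀ hp0
  refine ⟨hx, ?_⟩
  have key : ∀ ε, 0 < ε → ∃ τ, κ₀ ≤ τ ∧ x ^ 2 + 2 * (C * (τ - κ) ^ p) * x + τ < ε := by
    intro ε hε
    obtain ⟨τ, α, h1, -, h3, h4⟩ := h ε hε
    refine ⟨τ, h1, ?_⟩
    have h5 := (le_abs_self _).trans (Complex.abs_re_le_norm ((τ : ℂ) + 2 * x * α + (x : ℂ) ^ 2))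
    rw [quadratic_re, Complex.ofReal_re, Complex.ofReal_im] at h5
    nlinarith [mul_le_mul_of_nonpos_right h3 hx]
  obtain ⟨K, -, hK⟩ := exists_mul_rpow_le (q := p) (A := 2 * C * -x) (δ := 1 / 2) hp0.le hp1
    (mul_nonneg (by positivity) (by linarith)) (by norm_num)
  have hbd : ∀ τ, κ₀ ≤ τ → x ^ 2 + 2 * (C * (τ - κ) ^ p) * x + τ < 1 →
      τ ≤ 2 * (1 + K) + |κ| := by
    intro τ hτ h1
    have h2 := hK (τ - κ) (by linarith)
    nlinarith [sq_nonneg x, neg_abs_le κ]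
  obtain ⟨τ₁, hτ₁, hτ₁'⟩ := key 1 one_pos
  have hcont : Continuous fun τ : ℝ => x ^ 2 + 2 * (C * (τ - κ) ^ p) * x + τ :=
    (continuous_const.add ((continuous_const.mul
      (continuous_const.mul (continuous_sub_rpow κ hp0.le))).mul continuous_const)).add
        continuous_id
  obtain ⟨t, ht, hmin⟩ := isCompact_Icc.exists_isMinOn
    ⟨τ₁, hτ₁, hbd τ₁ hτ₁ hτ₁'⟩ hcont.continuousOn
  refine ⟨t, ht.1, not_lt.1 fun hpos => ?_⟩
  obtain ⟨τ, hτ, hτ'⟩ := key _ (lt_min hpos one_pos)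
  have h3 := hmin ⟨hτ, hbd τ hτ (hτ'.trans_le (min_le_right _ _))⟩
  exact absurd (hτ'.trans_le (min_le_left _ _)) (not_lt.2 h3)

end

end PencilBounds

/-! ### Coercivity and bounded invertibility -/

section LaxMilgram

variable {V H : Type*} [NormedAddCommGroup V] [InnerProductSpace ℂ V] [CompleteSpace V]
  [NormedAddCommGroup H] [InnerProductSpace ℂ H] [CompleteSpace H]

/-- A bounded sesquilinear form on a Hilbert space is represented by a bounded operator. -/
theorem exists_clm_of_bounded_sesq (q : V →ₗ[ℂ] V →ₛₗ[starRingEnd ℂ] ℂ) (M : ℝ)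
    (hq : ∀ f g, ‖q f g‖ ≤ M * ‖f‖ * ‖g‖) : ∃ A : V →L[ℂ] V, ∀ f g, inner ℂ g (A f) = q f g := by
  let B₀ : V →ₗ⋆[ℂ] V →ₗ[ℂ] ℂ := LinearMap.mk₂'ₛₗ (starRingEnd ℂ) (RingHom.id ℂ)
    (fun f g => starRingEnd ℂ (q f g)) (by simp) (by simp) (by simp) (by simp)
  have hB : ∀ f g, ‖B₀ f g‖ ≤ M * ‖f‖ * ‖g‖ := fun f g => by
    simpa [B₀] using hq f g
  refine ⟨InnerProductSpace.continuousLinearMapOfBilin (B₀.mkContinuous₂ M hB), fun f g => ?_⟩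
  rw [← inner_conj_symm, InnerProductSpace.continuousLinearMapOfBilin_apply]
  simp [B₀]

/-- The operator domain is a core: if `A` represents an elliptic form on `V`, the vectors `v`
for which `(A v, u)` is a bounded functional of `J u` are dense in `V`. They contain the image of the
dense range of the adjoint of `J` under the inverse of an isomorphism. -/
theorem dense_operator_domain (J : V →L[ℂ] H) (hJ : Function.Injective J)
    (A : V →L[ℂ] V) {c K : ℝ} (hc : 0 < c)
    (hell : ∀ v, c * ‖v‖ ^ 2 ≤ (inner ℂ v (A v)).re + K * ‖J v‖ ^ 2) :
    Dense {v : V | ∃ w : H, ∀ u, inner ℂ u (A v) = inner ℂ (J u) w} := by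
  set AK : V →L[ℂ] V := A + (K : ℂ) • (J.adjoint ∘L J) with hAK
  have hAKi : ∀ u v, inner ℂ u (AK v) = inner ℂ u (A v) + K * inner ℂ (J u) (J v) := by
    intro u v
    simp [hAK, ContinuousLinearMap.adjoint_inner_right]
  have hunit : IsUnit AK := by
    refine ContinuousLinearMap.isUnit_of_forall_le_norm_inner_map AK (c := ⟨c, hc.le⟩) hc
      fun v => ?_
    rw [norm_inner_symm]
    refine le_trans ?_ (Complex.re_le_norm _)
    have h1 : (inner ℂ (J v) (J v) : ℂ) = ((‖J v‖ ^ 2 : ℝ) : ℂ) := by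
      rw [inner_self_eq_norm_sq_to_K]; norm_num
    rw [hAKi, h1, ← Complex.ofReal_mul, Complex.add_re, Complex.ofReal_re]
    have := hell v
    change ‖v‖ ^ 2 * c ≤ _
    linarith
  obtain ⟨U, hU⟩ := hunit
  have hUr : ∀ v, AK ((↑U⁻¹ : V →L[ℂ] V) v) = v := fun v => by
    rw [← hU, ← mul_apply_eq_comp, Units.mul_inv, one_apply_eq_self]
  have hUl : ∀ v, (↑U⁻¹ : V →L[ℂ] V) (AK v) = v := fun v => by
    rw [← hU, ← mul_apply_eq_comp, Units.inv_mul, one_apply_eq_self]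
  have hadj : DenseRange J.adjoint := by
    have h1 : (J.adjoint.range)ᗮ = ⊥ := by
      rw [ContinuousLinearMap.orthogonal_range, ContinuousLinearMap.adjoint_adjoint]
      exact LinearMap.ker_eq_bot.2 hJ
    have h2 := (Submodule.topologicalClosure_eq_top_iff (K := J.adjoint.range)).2 h1
    exact Submodule.dense_iff_topologicalClosure_eq_top.2 h2
  have hsurj : Function.Surjective (↑U⁻¹ : V →L[ℂ] V) := fun v => ⟨AK v, hUl v⟩
  refine (hsurj.denseRange.comp hadj (↑U⁻¹ : V →L[ℂ] V).continuous).mono ?_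
  rintro _ ⟨w, rfl⟩
  refine ⟨w - (K : ℂ) • J ((↑U⁻¹ : V →L[ℂ] V) (J.adjoint w)), fun u => ?_⟩
  have h1 := hAKi u ((↑U⁻¹ : V →L[ℂ] V) (J.adjoint w))
  rw [hUr, ContinuousLinearMap.adjoint_inner_right] at h1
  rw [inner_sub_right, inner_smul_right, h1]
  simp

/-- If an elliptic form is bounded away from zero on the unit vectors of its operator domain, then
its operator is boundedly invertible. The lower bound extends from the core to the whole form
domain, where with ellipticity it becomes coercivity in absolute value. -/
theorem exists_resolvent_of_lower_bound (J : V →L[ℂ] H) (hJ : Function.Injective J)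
    (q : V →ₗ[ℂ] V →ₛₗ[starRingEnd ℂ] ℂ) {M c K ε : ℝ}
    (hq : ∀ f g, ‖q f g‖ ≤ M * ‖f‖ * ‖g‖) (hc : 0 < c) (hK : 0 ≤ K) (hε : 0 < ε)
    (hell : ∀ v, c * ‖v‖ ^ 2 ≤ (q v v).re + K * ‖J v‖ ^ 2)
    (hlow : ∀ v, (∃ w : H, ∀ u, q v u = inner ℂ (J u) w) → ε * ‖J v‖ ^ 2 ≤ ‖q v v‖) :
    ∃ R : H →L[ℂ] V, (∀ y u, q (R y) u = inner ℂ (J u) y) ∧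
      ∀ v w, (∀ u, q v u = inner ℂ (J u) w) → R w = v := by
  obtain ⟨A, hA⟩ := exists_clm_of_bounded_sesq q M hq
  simp_rw [← hA] at hell hlow ⊢
  have hdense := dense_operator_domain J hJ A hc hell
  have hlow' : ∀ v, ε * ‖J v‖ ^ 2 ≤ ‖inner ℂ v (A v)‖ := by
    intro v
    have hcl : IsClosed {v : V | ε * ‖J v‖ ^ 2 ≤ ‖inner ℂ v (A v)‖} :=
      isClosed_le (by fun_prop) (continuous_id.inner A.continuous).norm
    exact hcl.closure_subset_iff.2 (fun v hv => hlow v hv) (hdense v)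
  have hunit : IsUnit A := by
    have hc' : 0 < c / (1 + K / ε) := by positivity
    refine ContinuousLinearMap.isUnit_of_forall_le_norm_inner_map A (c := ⟨_, hc'.le⟩) hc'
      fun v => ?_
    rw [norm_inner_symm]
    change ‖v‖ ^ 2 * (c / (1 + K / ε)) ≤ _
    rw [mul_div_assoc', div_le_iff₀ (by positivity)]
    have h1 := hell v
    have h2 := Complex.re_le_norm (inner ℂ v (A v))
    have h3 : K * ‖J v‖ ^ 2 ≤ K / ε * ‖inner ℂ v (A v)‖ := by
      calc K * ‖J v‖ ^ 2 = K / ε * (ε * ‖J v‖ ^ 2) := by field_simp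
        _ ≤ _ := mul_le_mul_of_nonneg_left (hlow' v) (by positivity)
    linarith
  obtain ⟨U, hU⟩ := hunit
  refine ⟨(↑U⁻¹ : V →L[ℂ] V) ∘L J.adjoint, fun y u => ?_, fun v w h => ?_⟩
  · have : A ((↑U⁻¹ : V →L[ℂ] V) (J.adjoint y)) = J.adjoint y := by
      rw [← hU, ← mul_apply_eq_comp, Units.mul_inv, one_apply_eq_self]
    rw [ContinuousLinearMap.comp_apply, this, ContinuousLinearMap.adjoint_inner_right]
  · have h1 : A v = J.adjoint w := ext_inner_left ℂ fun u => by
      rw [h, ContinuousLinearMap.adjoint_inner_right]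
    rw [ContinuousLinearMap.comp_apply, ← h1, ← hU, ← mul_apply_eq_comp,
      Units.inv_mul, one_apply_eq_self]

end LaxMilgram

/-! ### Form spaces, associated operators and the pseudo numerical range -/

namespace SesqForm

variable {H : Type*} [NormedAddCommGroup H] [InnerProductSpace ℂ H]

theorem BoundedBelowBy.quad_eq {t : SesqForm H} {γ : ℝ} (ht : t.BoundedBelowBy γ) (f : t.domain) :
    t.quad f = ((t.quad f).re : ℂ) :=
  (Complex.conj_eq_iff_re.1 (ht.1 f f).symm).symm

theorem BoundedBelowBy.mono {t : SesqForm H} {γ δ : ℝ} (ht : t.BoundedBelowBy γ) (h : δ ≤ γ) :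
    t.BoundedBelowBy δ :=
  ⟨ht.1, fun f => (mul_le_mul_of_nonneg_right h (sq_nonneg _)).trans (ht.2 f)⟩

theorem BoundedBelowBy.quad_nonneg {t : SesqForm H} (ht : t.BoundedBelowBy 0) (f : t.domain) :
    0 ≤ (t.quad f).re := by simpa using ht.2 f

/-- The Cauchy–Schwarz inequality for a nonnegative symmetric form. -/
theorem BoundedBelowBy.norm_sq_le {t : SesqForm H} (ht : t.BoundedBelowBy 0) (f g : t.domain) :
    ‖t.toFun f g‖ ^ 2 ≤ (t.quad f).re * (t.quad g).re := by
  let core : PreInnerProductSpace.Core ℂ t.domain :=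
    { inner := fun x y => t.toFun y x
      conj_inner_symm := fun x y => (ht.1 y x).symm
      re_inner_nonneg := fun x => ht.quad_nonneg x
      add_left := fun x y z => by simp
      smul_left := fun x y r => by simp }
  have h := @InnerProductSpace.Core.inner_mul_inner_self_le ℂ t.domain _ _ _ core f g
  change ‖t.toFun g f‖ * ‖t.toFun f g‖ ≤ (t.quad f).re * (t.quad g).re at h
  rwa [ht.1 g f, RCLike.norm_conj, ← sq] at h

theorem quad_smul (t : SesqForm H) (c : ℂ) (f : t.domain) :
    t.quad (c • f) = ((‖c‖ ^ 2 : ℝ) : ℂ) * t.quad f := by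
  simp only [quad, map_smul, LinearMap.smul_apply, LinearMap.map_smulₛₗ, smul_eq_mul]
  rw [← mul_assoc, mul_comm (starRingEnd ℂ c), Complex.mul_conj, Complex.normSq_eq_norm_sq]

/-- The domain of a nonnegative form as a space of its own, to carry the inner product
`t[g, f] + (f, g)` rather than the one induced by `H`. -/
def FormSpace (t : SesqForm H) (_ : t.BoundedBelowBy 0) : Type _ := t.domain

section FormSpace

variable (t : SesqForm H) (ht : t.BoundedBelowBy 0)

instance : AddCommGroup (t.FormSpace ht) := inferInstanceAs (AddCommGroup t.domain)

instance : Module ℂ (t.FormSpace ht) := inferInstanceAs (Module ℂ t.domain)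

/-- The tautological linear bijection from the form space to the domain. -/
def formEquiv : t.FormSpace ht ≃ₗ[ℂ] t.domain := LinearEquiv.refl ℂ t.domain

/-- The inner product of the form space, conjugate linear in the first argument. -/
noncomputable abbrev formCore : InnerProductSpace.Core ℂ (t.FormSpace ht) where
  inner x y := t.toFun (t.formEquiv ht y) (t.formEquiv ht x)
    + inner ℂ (t.formEquiv ht x : H) (t.formEquiv ht y : H)
  conj_inner_symm x y := by
    rw [map_add, inner_conj_symm, ← ht.1]
  re_inner_nonneg x := add_nonneg (ht.quad_nonneg _) (inner_self_nonneg (𝕜 := ℂ))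
  add_left x y z := by
    simp only [map_add, Submodule.coe_add, inner_add_left]
    ring
  smul_left x y r := by
    simp only [map_smul, LinearMap.map_smulₛₗ, Submodule.coe_smul, inner_smul_left, smul_eq_mul]
    ring
  definite x hx := by
    have h1 := ht.quad_nonneg (t.formEquiv ht x)
    have h2 : (t.quad (t.formEquiv ht x)).re + ‖(t.formEquiv ht x : H)‖ ^ 2 = 0 := by
      rw [← inner_self_eq_norm_sq (𝕜 := ℂ)]
      exact congrArg Complex.re hx
    have h3 : ‖(t.formEquiv ht x : H)‖ = 0 :=
      pow_eq_zero_iff two_ne_zero |>.1 (by linarith [sq_nonneg ‖(t.formEquiv ht x : H)‖])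
    exact (t.formEquiv ht).map_eq_zero_iff.1 (Subtype.ext (norm_eq_zero.1 h3))

noncomputable instance : NormedAddCommGroup (t.FormSpace ht) :=
  (t.formCore ht).toNormedAddCommGroup

noncomputable instance : InnerProductSpace ℂ (t.FormSpace ht) :=
  InnerProductSpace.ofCore (t.formCore ht).toCore

theorem formSpace_norm_sq (v : t.FormSpace ht) :
    ‖v‖ ^ 2 = (t.quad (t.formEquiv ht v)).re + ‖(t.formEquiv ht v : H)‖ ^ 2 := by
  rw [← inner_self_eq_norm_sq (𝕜 := ℂ) v, ← inner_self_eq_norm_sq (𝕜 := ℂ) (t.formEquiv ht v : H)]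
  rfl

theorem norm_formEquiv_le (v : t.FormSpace ht) : ‖(t.formEquiv ht v : H)‖ ≤ ‖v‖ := by
  have h1 := formSpace_norm_sq t ht v
  have h2 := ht.quad_nonneg (t.formEquiv ht v)
  exact (sq_le_sq₀ (norm_nonneg _) (norm_nonneg _)).1 (by linarith)

/-- The embedding of the form space into `H`. -/
noncomputable def formIncl : t.FormSpace ht →L[ℂ] H :=
  LinearMap.mkContinuous (t.domain.subtype ∘ₗ (t.formEquiv ht).toLinearMap) 1 fun v => by
    simpa using norm_formEquiv_le t ht v

theorem formIncl_injective : Function.Injective (t.formIncl ht) := fun _ _ h =>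
  (t.formEquiv ht).injective (Subtype.ext h)

/-- The form space of a closed form is complete. -/
theorem completeSpace_formSpace [CompleteSpace H] (hcl : t.IsClosedForm) :
    CompleteSpace (t.FormSpace ht) := by
  refine Metric.complete_of_cauchySeq_tendsto fun u hu => ?_
  have hH : CauchySeq fun n => t.formIncl ht (u n) :=
    hu.map (t.formIncl ht).uniformContinuous
  obtain ⟨x, hx⟩ := cauchySeq_tendsto_of_complete hH
  have hquad : ∀ v : t.FormSpace ht, ‖t.quad (t.formEquiv ht v)‖ ≤ ‖v‖ ^ 2 := fun v => by
    rw [ht.quad_eq, Complex.norm_real, Real.norm_of_nonneg (ht.quad_nonneg _),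
      formSpace_norm_sq]
    linarith [sq_nonneg ‖(t.formEquiv ht v : H)‖]
  have hdist : Tendsto (fun nm : ℕ × ℕ => ‖u nm.1 - u nm.2‖ ^ 2) atTop (𝓝 0) := by
    have h1 := cauchySeq_iff_tendsto_dist_atTop_0.1 hu
    simpa [dist_eq_norm] using h1.pow 2
  obtain ⟨hxd, hlim⟩ := hcl (fun n => t.formEquiv ht (u n)) x hx
    (squeeze_zero_norm (fun nm => by simpa using hquad (u nm.1 - u nm.2)) hdist)
  refine ⟨(t.formEquiv ht).symm ⟨x, hxd⟩, tendsto_iff_norm_sub_tendsto_zero.2 ?_⟩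
  have h2 : Tendsto (fun n => ‖u n - (t.formEquiv ht).symm ⟨x, hxd⟩‖ ^ 2) atTop (𝓝 0) := by
    have h3 := (Complex.continuous_re.tendsto 0).comp hlim
    have h4 := ((tendsto_iff_norm_sub_tendsto_zero.1 hx).pow 2)
    have h5 := h3.add h4
    simp only [Complex.zero_re, ne_eq, OfNat.ofNat_ne_zero, not_false_eq_true, zero_pow,
      add_zero] at h5
    refine h5.congr fun n => ?_
    rw [formSpace_norm_sq, map_sub, LinearEquiv.apply_symm_apply]
    rfl
  have h6 := h2.sqrt
  simpa using h6

end FormSpace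

theorem mem_operatorGraph_iff (t : SesqForm H) (ht : t.DenselyDefined) (u w : H) :
    (u, w) ∈ t.operatorGraph ↔ ∃ h : u ∈ t.operator.domain, t.operator ⟨u, h⟩ = w := by
  rw [← operator_graph t ht, LinearPMap.mem_graph_iff]
  constructor
  · rintro ⟨⟨y, hy⟩, rfl, h⟩
    exact ⟨hy, h⟩
  · rintro ⟨h, e⟩
    exact ⟨⟨u, h⟩, rfl, e⟩

theorem operator_spec (t : SesqForm H) (ht : t.DenselyDefined) (f : t.operator.domain) :
    ∃ hf : (f : H) ∈ t.domain, ∀ v, t.toFun ⟨f, hf⟩ v = inner ℂ (v : H) (t.operator f) :=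
  (mem_operatorGraph_iff t ht f (t.operator f)).2 ⟨f.2, rfl⟩

end SesqForm

namespace OpFamily

variable {H : Type*} [NormedAddCommGroup H] [InnerProductSpace ℂ H]

/-- The pseudo numerical range consists of the approximate zeros of the quadratic form of `T(l)`:
a perturbation by the scalar `-(T(l) f, f) / ‖f‖²` turns an approximate zero into a zero. -/
theorem mem_pseudoNumRange_iff (T : ℂ → H →ₗ.[ℂ] H) (l : ℂ) :
    l ∈ pseudoNumRange T ↔ ∀ ε : ℝ, 0 < ε → ∃ f : (T l).domain, (f : H) ≠ 0 ∧
      ‖inner ℂ (f : H) (T l f)‖ < ε * ‖(f : H)‖ ^ 2 := by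
  simp only [pseudoNumRange, epsPseudoNumRange, Set.mem_iInter, Set.mem_iUnion, Set.mem_Ioi,
    Set.mem_ofPred_eq]
  refine forall₂_congr fun ε hε => ?_
  constructor
  · rintro ⟨B, hB, f, hf, h⟩
    have hf0 : 0 < ‖(f : H)‖ := norm_pos_iff.2 hf
    refine ⟨f, hf, ?_⟩
    have h' : inner ℂ (f : H) (B f) + inner ℂ (f : H) (T l f) = 0 := by
      rw [← inner_add_right]
      exact h
    rw [eq_neg_of_add_eq_zero_right h', norm_neg]
    calc ‖inner ℂ (f : H) (B f)‖ ≤ ‖(f : H)‖ * ‖B f‖ := norm_inner_le_norm _ _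
      _ ≤ ‖(f : H)‖ * (‖B‖ * ‖(f : H)‖) := by gcongr; exact B.le_opNorm _
      _ = ‖B‖ * ‖(f : H)‖ ^ 2 := by ring
      _ < ε * ‖(f : H)‖ ^ 2 := by gcongr
  · rintro ⟨f, hf, h⟩
    have hf0 : 0 < ‖(f : H)‖ := norm_pos_iff.2 hf
    set c : ℂ := inner ℂ (f : H) (T l f) / ((‖(f : H)‖ ^ 2 : ℝ) : ℂ) with hc
    have hcn : ‖c‖ < ε := by
      rw [hc, norm_div, Complex.norm_real, Real.norm_of_nonneg (by positivity),
        div_lt_iff₀ (by positivity)]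
      exact h
    refine ⟨-(c • ContinuousLinearMap.id ℂ H), ?_, f, hf, ?_⟩
    · rw [norm_neg]
      refine lt_of_le_of_lt ?_ hcn
      rw [norm_smul]
      exact mul_le_of_le_one_right (norm_nonneg _) ContinuousLinearMap.norm_id_le
    · have e : ((-(c • ContinuousLinearMap.id ℂ H) : H →L[ℂ] H) : H →ₗ[ℂ] H) (f : H)
          = -(c • (f : H)) := rfl
      have e2 : ((((-(c • ContinuousLinearMap.id ℂ H) : H →L[ℂ] H) : H →ₗ[ℂ] H) +ᵥ T l) f)
          = -(c • (f : H)) + T l f := rfl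
      have e3 : inner ℂ (f : H) (f : H) = ((‖(f : H)‖ ^ 2 : ℝ) : ℂ) := by
        rw [inner_self_eq_norm_sq_to_K]; norm_num
      refine (congrArg (inner ℂ (f : H)) e2).trans ?_
      rw [inner_add_right, inner_neg_right, inner_smul_right, e3, hc,
        div_mul_cancel₀ _ (by exact_mod_cast (by positivity : ‖(f : H)‖ ^ 2 ≠ 0))]
      ring

end OpFamily

/-! ### The pencil of forms -/

namespace SesqForm

variable {H : Type*} [NormedAddCommGroup H] [InnerProductSpace ℂ H]

theorem abs_arg_le_pi_div_four {z : ℂ} (h : |z.im| ≤ z.re) : |z.arg| ≤ Real.pi / 4 := by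
  have hre : 0 ≤ z.re := (abs_nonneg _).trans h
  rcases eq_or_ne z 0 with rfl | hz
  · simp; positivity
  have hz0 : 0 < ‖z‖ := norm_pos_iff.2 hz
  have h1 : |z.im| / ‖z‖ ≤ √2 / 2 := by
    rw [div_le_iff₀ hz0]
    have h2 : ‖z‖ ^ 2 = z.re ^ 2 + z.im ^ 2 := by
      rw [← Complex.normSq_eq_norm_sq, Complex.normSq_apply]; ring
    have h3 : (√2 : ℝ) ^ 2 = 2 := Real.sq_sqrt (by norm_num)
    refine abs_le_of_sq_le_sq' ?_ (by positivity) |>.2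
    rw [mul_pow, div_pow, h3, h2, sq_abs]
    nlinarith [sq_abs z.im, abs_nonneg z.im]
  have hp := Real.pi_pos
  rw [Complex.arg_of_re_nonneg hre, abs_le]
  have h4 : |z.im / ‖z‖| ≤ √2 / 2 := by rwa [abs_div, abs_of_pos hz0]
  rw [abs_le] at h4
  constructor
  · rw [Real.le_arcsin_iff_sin_le' ⟨by linarith, by linarith⟩, Real.sin_neg,
      Real.sin_pi_div_four]
    exact h4.1
  · rw [Real.arcsin_le_iff_le_sin' ⟨by linarith, by linarith⟩, Real.sin_pi_div_four]
    exact h4.2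

section

variable (t₀ a : SesqForm H) (hdom : t₀.domain ≤ a.domain)

theorem pencil_apply (l : ℂ) (f g : t₀.domain) :
    (pencil t₀ a hdom l).toFun f g = t₀.toFun f g + 2 * l * a.toFun ⟨f, hdom f.2⟩ ⟨g, hdom g.2⟩
      + l ^ 2 * inner ℂ (g : H) (f : H) := rfl

theorem pencil_quad (l : ℂ) (f : t₀.domain) :
    (pencil t₀ a hdom l).quad f = t₀.quad f + 2 * l * a.quad ⟨f, hdom f.2⟩
      + l ^ 2 * ((‖(f : H)‖ ^ 2 : ℝ) : ℂ) := by
  have e : ((‖(f : H)‖ ^ 2 : ℝ) : ℂ) = inner ℂ (f : H) (f : H) := by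
    rw [inner_self_eq_norm_sq_to_K]; norm_num
  rw [e]
  rfl

/-- The form `a` is bounded relative to `t₀` with relative bound `0`. -/
def IsRelativelySmall : Prop :=
  ∀ δ : ℝ, 0 < δ → ∃ K : ℝ, 0 ≤ K ∧ ∀ f : t₀.domain,
    (a.quad ⟨f, hdom f.2⟩).re ≤ δ * (t₀.quad f).re + K * ‖(f : H)‖ ^ 2

variable {t₀ a hdom}

theorem isRelativelySmall_of_rpow {κ₀ κ p C : ℝ} (ht₀ : t₀.BoundedBelowBy κ₀) (hκ : κ ≤ κ₀)
    (hp0 : 0 < p) (hp1 : p < 1) (hC : 0 < C)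
    (hsub : ∀ f : t₀.domain, (a.quad ⟨f, hdom f.2⟩).re ≤
      C * ((t₀.quad f).re - κ * ‖(f : H)‖ ^ 2) ^ p * (‖(f : H)‖ ^ 2) ^ (1 - p)) :
    IsRelativelySmall t₀ a hdom := by
  intro δ hδ
  obtain ⟨K, hK0, hK⟩ := PencilBounds.exists_mul_rpow_le hp0.le hp1 hC.le hδ
  refine ⟨K + δ * |κ|, by positivity, fun f => ?_⟩
  refine (hsub f).trans ?_
  have h1 := (ht₀.mono hκ).2 f
  set N := ‖(f : H)‖ ^ 2
  set s := (t₀.quad f).re - κ * N with hs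
  have hs0 : 0 ≤ s := by linarith
  have h2 : C * s ^ p * N ^ (1 - p) ≤ δ * s + K * N := by
    have hN : 0 ≤ N := sq_nonneg _
    rcases hN.eq_or_lt with h0 | h0
    · rw [← h0, Real.zero_rpow (by linarith)]
      linarith [mul_nonneg hδ.le hs0]
    · have h3 := mul_le_mul_of_nonneg_right (hK (s / N) (by positivity)) h0.le
      have h4 : N ^ p * N ^ (1 - p) = N := by rw [← Real.rpow_add h0]; simp
      have h5 : 0 < N ^ p := Real.rpow_pos_of_pos h0 _
      calc C * s ^ p * N ^ (1 - p) = C * (s / N) ^ p * N := by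
            rw [Real.div_rpow hs0 h0.le, eq_div_of_mul_eq h5.ne' ((mul_comm _ _).trans h4)]
            field_simp
        _ ≤ (δ * (s / N) + K) * N := h3
        _ = δ * s + K * N := by field_simp
  have h6 : -(δ * κ * N) ≤ δ * |κ| * N := by
    have h7 : δ * N * -κ ≤ δ * N * |κ| :=
      mul_le_mul_of_nonneg_left (neg_le_abs κ) (by positivity)
    linarith
  calc _ ≤ δ * s + K * N := h2
    _ ≤ _ := by rw [hs]; linarith

theorem exists_abs_im_add_le_re (ht₀ : t₀.BoundedBelowBy 0) (ha : a.BoundedBelowBy 0)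
    (hrel : IsRelativelySmall t₀ a hdom) (l : ℂ) : ∃ K : ℝ, 0 ≤ K ∧ ∀ f : t₀.domain,
    |((pencil t₀ a hdom l).quad f).im| + (t₀.quad f).re / 2
      ≤ ((pencil t₀ a hdom l).quad f).re + K * ‖(f : H)‖ ^ 2 := by
  obtain ⟨K, hK0, hK⟩ := hrel (1 / (8 * (‖l‖ + 1))) (by positivity)
  refine ⟨4 * ‖l‖ * K + 2 * ‖l‖ ^ 2, by positivity, fun f => ?_⟩
  have h1 := hK f
  have ht := ht₀.quad_nonneg f
  have haf := ha.quad_nonneg ⟨f, hdom f.2⟩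
  rw [pencil_quad, ht₀.quad_eq f, ha.quad_eq ⟨f, hdom f.2⟩]
  set τ := (t₀.quad f).re
  set α := (a.quad ⟨f, hdom f.2⟩).re
  set N := ‖(f : H)‖ ^ 2
  have hN : 0 ≤ N := sq_nonneg _
  set w : ℂ := 2 * l * (α : ℂ) + l ^ 2 * (N : ℂ) with hw
  have hwn : ‖w‖ ≤ 2 * ‖l‖ * α + ‖l‖ ^ 2 * N := by
    refine (norm_add_le _ _).trans ?_
    simp [abs_of_nonneg haf, abs_of_nonneg hN]
  have h2 := Complex.abs_im_le_norm w
  have h3 := (neg_abs_le _).trans' (neg_le_neg (Complex.abs_re_le_norm w))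
  rw [add_assoc, ← hw, Complex.add_im, Complex.add_re, Complex.ofReal_re, Complex.ofReal_im,
    zero_add]
  have h4 : 4 * ‖l‖ * α ≤ τ / 2 + 4 * ‖l‖ * K * N := by
    have h5 := mul_le_mul_of_nonneg_left h1 (by positivity : 0 ≤ 4 * ‖l‖)
    have h6 : 4 * ‖l‖ * (1 / (8 * (‖l‖ + 1)) * τ) ≤ τ / 2 := by
      have h7 : 4 * ‖l‖ * (1 / (8 * (‖l‖ + 1)) * τ) = ‖l‖ / (‖l‖ + 1) * (τ / 2) := by
        field_simp; ring
      rw [h7]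
      refine mul_le_of_le_one_left (by positivity) ?_
      rw [div_le_one (by positivity)]
      linarith
    linarith
  linarith

theorem pencil_isSectorial (ht₀ : t₀.BoundedBelowBy 0) (ha : a.BoundedBelowBy 0)
    (hrel : IsRelativelySmall t₀ a hdom) (l : ℂ) : (pencil t₀ a hdom l).IsSectorial := by
  obtain ⟨K, -, hK⟩ := exists_abs_im_add_le_re ht₀ ha hrel l
  refine ⟨-K, Real.pi / 4, by positivity, by linarith [Real.pi_pos], ?_⟩
  rintro z ⟨f, hf, rfl⟩
  refine abs_arg_le_pi_div_four ?_
  have h1 := hK f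
  have hf' : ‖((show t₀.domain from f) : H)‖ = 1 := hf
  rw [hf'] at h1
  have h2 := ht₀.quad_nonneg f
  simp only [Complex.sub_im, Complex.sub_re, Complex.ofReal_im, Complex.ofReal_re, sub_zero]
  linarith

theorem tendsto_pencil_quad_zero (ha : a.BoundedBelowBy 0)
    (hrel : IsRelativelySmall t₀ a hdom) {ι : Type*} {F : Filter ι} (l : ℂ) (u : ι → t₀.domain)
    (hu : Tendsto (fun i => (u i : H)) F (𝓝 0))
    (ht : Tendsto (fun i => t₀.quad (u i)) F (𝓝 0)) :
    Tendsto (fun i => (pencil t₀ a hdom l).quad (u i)) F (𝓝 0) := by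
  have hN : Tendsto (fun i => ‖(u i : H)‖ ^ 2) F (𝓝 0) := by
    simpa using (hu.norm.pow 2)
  have htr : Tendsto (fun i => (t₀.quad (u i)).re) F (𝓝 0) :=
    (Complex.continuous_re.tendsto 0).comp ht
  obtain ⟨K, -, hK⟩ := hrel 1 one_pos
  have hα : Tendsto (fun i => a.quad ⟨u i, hdom (u i).2⟩) F (𝓝 0) := by
    refine squeeze_zero_norm (a := fun i => 1 * (t₀.quad (u i)).re + K * ‖(u i : H)‖ ^ 2)
      (fun i => ?_) ?_
    · rw [ha.quad_eq, Complex.norm_real, Real.norm_of_nonneg (ha.quad_nonneg _)]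
      exact hK (u i)
    · simpa using (htr.const_mul 1).add (hN.const_mul K)
  have hNc : Tendsto (fun i => ((‖(u i : H)‖ ^ 2 : ℝ) : ℂ)) F (𝓝 0) := by
    have := (Complex.continuous_ofReal.tendsto 0).comp hN
    rwa [Complex.ofReal_zero] at this
  have h := (ht.add (hα.const_mul (2 * l))).add (hNc.const_mul (l ^ 2))
  simp only [mul_zero, add_zero] at h
  exact h.congr fun i => (pencil_quad t₀ a hdom l (u i)).symm

theorem pencil_isClosedForm (ht₀ : t₀.BoundedBelowBy 0) (ha : a.BoundedBelowBy 0)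
    (hrel : IsRelativelySmall t₀ a hdom) (hcl : t₀.IsClosedForm) (l : ℂ) :
    (pencil t₀ a hdom l).IsClosedForm := by
  suffices h : ∀ (u : ℕ → t₀.domain) (x : H), Tendsto (fun n => (u n : H)) atTop (𝓝 x) →
      Tendsto (fun nm : ℕ × ℕ => (pencil t₀ a hdom l).quad (u nm.1 - u nm.2 : t₀.domain))
        atTop (𝓝 0) →
      ∃ hx : x ∈ t₀.domain, Tendsto (fun n =>
        (pencil t₀ a hdom l).quad (u n - ⟨x, hx⟩ : t₀.domain)) atTop (𝓝 0) from h
  intro u x hux hquad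
  obtain ⟨K, -, hK⟩ := exists_abs_im_add_le_re ht₀ ha hrel l
  have hdiff : Tendsto (fun nm : ℕ × ℕ => ((u nm.1 - u nm.2 : t₀.domain) : H)) atTop (𝓝 0) := by
    have h1 : Tendsto (fun nm : ℕ × ℕ => (u nm.1 : H) - u nm.2) (atTop ×ˢ atTop) (𝓝 (x - x)) :=
      (hux.comp tendsto_fst).sub (hux.comp tendsto_snd)
    rw [sub_self, prod_atTop_atTop_eq] at h1
    exact h1
  have ht : Tendsto (fun nm : ℕ × ℕ => t₀.quad (u nm.1 - u nm.2)) atTop (𝓝 0) := by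
    refine squeeze_zero_norm (a := fun nm : ℕ × ℕ =>
      2 * (((pencil t₀ a hdom l).quad (u nm.1 - u nm.2 : t₀.domain)).re
        + K * ‖((u nm.1 - u nm.2 : t₀.domain) : H)‖ ^ 2)) (fun nm => ?_) ?_
    · rw [ht₀.quad_eq, Complex.norm_real, Real.norm_of_nonneg (ht₀.quad_nonneg _)]
      have h2 := hK (u nm.1 - u nm.2)
      have h3 := abs_nonneg ((pencil t₀ a hdom l).quad (u nm.1 - u nm.2 : t₀.domain)).im
      linarith
    · have h4 := (Complex.continuous_re.tendsto 0).comp hquad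
      have h5 := (h4.add ((hdiff.norm.pow 2).const_mul K)).const_mul 2
      simpa using h5
  obtain ⟨hx, hlim⟩ := hcl u x hux ht
  have hdiff' : Tendsto (fun n => ((u n - ⟨x, hx⟩ : t₀.domain) : H)) atTop (𝓝 0) := by
    have h6 := hux.sub_const x
    rw [sub_self] at h6
    exact h6
  have h7 := tendsto_pencil_quad_zero (hdom := hdom) (F := atTop) ha hrel l
    (fun n => (u n - ⟨x, hx⟩ : t₀.domain))
  exact ⟨hx, h7 hdiff' hlim⟩

theorem pencil_holomorphicTypeA (ht₀ : t₀.BoundedBelowBy 0) (ha : a.BoundedBelowBy 0)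
    (hrel : IsRelativelySmall t₀ a hdom) (hd : t₀.DenselyDefined) (hcl : t₀.IsClosedForm) :
    HolomorphicTypeA (pencil t₀ a hdom) := by
  refine ⟨fun l => ⟨pencil_isSectorial ht₀ ha hrel l, pencil_isClosedForm ht₀ ha hrel hcl l⟩,
    t₀.domain, fun l => rfl, hd, fun u => ?_⟩
  have e : (fun l => (pencil t₀ a hdom l).quad u) = fun l => t₀.quad u
      + 2 * l * a.quad ⟨u, hdom u.2⟩ + l ^ 2 * ((‖(u : H)‖ ^ 2 : ℝ) : ℂ) :=
    funext fun l => pencil_quad t₀ a hdom l u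
  change Differentiable ℂ fun l => (pencil t₀ a hdom l).quad u
  rw [e]
  fun_prop

/-- The pencil is a bounded sesquilinear form on the form space of `t₀`. -/
theorem exists_norm_pencil_le (ht₀ : t₀.BoundedBelowBy 0) (ha : a.BoundedBelowBy 0)
    (hrel : IsRelativelySmall t₀ a hdom) (l : ℂ) : ∃ M : ℝ, ∀ f g : t₀.FormSpace ht₀,
    ‖(pencil t₀ a hdom l).toFun (t₀.formEquiv ht₀ f) (t₀.formEquiv ht₀ g)‖
      ≤ M * ‖f‖ * ‖g‖ := by
  obtain ⟨K, hK0, hK⟩ := hrel 1 one_pos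
  have hquad : ∀ f : t₀.FormSpace ht₀, (t₀.quad (t₀.formEquiv ht₀ f)).re ≤ ‖f‖ ^ 2 := fun f => by
    rw [formSpace_norm_sq]; linarith [sq_nonneg ‖(t₀.formEquiv ht₀ f : H)‖]
  have hN : ∀ f : t₀.FormSpace ht₀, ‖(t₀.formEquiv ht₀ f : H)‖ ^ 2 ≤ ‖f‖ ^ 2 := fun f => by
    rw [formSpace_norm_sq]; linarith [ht₀.quad_nonneg (t₀.formEquiv ht₀ f)]
  have haq : ∀ f : t₀.FormSpace ht₀,
      (a.quad ⟨t₀.formEquiv ht₀ f, hdom (t₀.formEquiv ht₀ f).2⟩).re ≤ (1 + K) * ‖f‖ ^ 2 :=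
    fun f => by
      refine (hK _).trans ?_
      nlinarith [hquad f, mul_le_mul_of_nonneg_left (hN f) hK0]
  refine ⟨1 + 2 * ‖l‖ * (1 + K) + ‖l‖ ^ 2, fun f g => ?_⟩
  set f' := t₀.formEquiv ht₀ f with hf'
  set g' := t₀.formEquiv ht₀ g with hg'
  have h1 : ‖t₀.toFun f' g'‖ ≤ ‖f‖ * ‖g‖ := by
    refine (sq_le_sq₀ (norm_nonneg _) (by positivity)).1 ((ht₀.norm_sq_le f' g').trans ?_)
    rw [mul_pow]
    exact mul_le_mul (hquad f) (hquad g) (ht₀.quad_nonneg _) (sq_nonneg _)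
  have h2 : ‖a.toFun ⟨f', hdom f'.2⟩ ⟨g', hdom g'.2⟩‖ ≤ (1 + K) * (‖f‖ * ‖g‖) := by
    refine (sq_le_sq₀ (norm_nonneg _) (by positivity)).1 ((ha.norm_sq_le _ _).trans ?_)
    rw [show ((1 + K) * (‖f‖ * ‖g‖)) ^ 2 = ((1 + K) * ‖f‖ ^ 2) * ((1 + K) * ‖g‖ ^ 2) by ring]
    exact mul_le_mul (haq f) (haq g) (ha.quad_nonneg _) (by positivity)
  have h3 : ‖inner ℂ (g' : H) (f' : H)‖ ≤ ‖f‖ * ‖g‖ := by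
    rw [mul_comm]
    exact (norm_inner_le_norm _ _).trans (mul_le_mul (norm_formEquiv_le t₀ ht₀ g)
      (norm_formEquiv_le t₀ ht₀ f) (norm_nonneg _) (norm_nonneg _))
  rw [pencil_apply]
  calc _ ≤ ‖t₀.toFun f' g'‖ + 2 * ‖l‖ * ‖a.toFun ⟨f', hdom f'.2⟩ ⟨g', hdom g'.2⟩‖
        + ‖l‖ ^ 2 * ‖inner ℂ (g' : H) (f' : H)‖ := by
        refine norm_add₃_le.trans (le_of_eq ?_)
        simp
    _ ≤ ‖f‖ * ‖g‖ + 2 * ‖l‖ * ((1 + K) * (‖f‖ * ‖g‖)) + ‖l‖ ^ 2 * (‖f‖ * ‖g‖) := by gcongr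
    _ = _ := by ring

/-- Outside the pseudo numerical range the form is bounded away from zero on the unit vectors of
the operator domain, hence the operator is boundedly invertible. -/
theorem spectrum_subset_pseudoNumRange (ht₀ : t₀.BoundedBelowBy 0) (ha : a.BoundedBelowBy 0)
    (hrel : IsRelativelySmall t₀ a hdom) [CompleteSpace H] (hd : t₀.DenselyDefined)
    (hcl : t₀.IsClosedForm) :
    OpFamily.spectrum (fun l => (pencil t₀ a hdom l).operator)
      ⊆ OpFamily.pseudoNumRange fun l => (pencil t₀ a hdom l).operator := by
  intro l hl
  by_contra hcon
  refine hl ?_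
  rw [OpFamily.mem_pseudoNumRange_iff] at hcon
  push Not at hcon
  obtain ⟨ε, hε, hlow⟩ := hcon
  have hdl : (pencil t₀ a hdom l).DenselyDefined := hd
  have : CompleteSpace (t₀.FormSpace ht₀) := completeSpace_formSpace t₀ ht₀ hcl
  obtain ⟨M, hM⟩ := exists_norm_pencil_le ht₀ ha hrel l
  obtain ⟨K, hK0, hK⟩ := exists_abs_im_add_le_re ht₀ ha hrel l
  let q : t₀.FormSpace ht₀ →ₗ[ℂ] t₀.FormSpace ht₀ →ₛₗ[starRingEnd ℂ] ℂ :=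
    LinearMap.mk₂'ₛₗ (RingHom.id ℂ) (starRingEnd ℂ)
      (fun v u => (pencil t₀ a hdom l).toFun (t₀.formEquiv ht₀ v) (t₀.formEquiv ht₀ u))
      (fun v₁ v₂ u => LinearMap.map_add₂ (pencil t₀ a hdom l).toFun (t₀.formEquiv ht₀ v₁)
        (t₀.formEquiv ht₀ v₂) (t₀.formEquiv ht₀ u))
      (fun c v u => LinearMap.map_smulₛₗ₂ (pencil t₀ a hdom l).toFun c (t₀.formEquiv ht₀ v)
        (t₀.formEquiv ht₀ u))
      (fun v u₁ u₂ => map_add ((pencil t₀ a hdom l).toFun (t₀.formEquiv ht₀ v))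
        (t₀.formEquiv ht₀ u₁) (t₀.formEquiv ht₀ u₂))
      (fun c v u => map_smulₛₗ ((pencil t₀ a hdom l).toFun (t₀.formEquiv ht₀ v)) c
        (t₀.formEquiv ht₀ u))
  have hqv : ∀ v u, q v u
      = (pencil t₀ a hdom l).toFun (t₀.formEquiv ht₀ v) (t₀.formEquiv ht₀ u) := fun v u => rfl
  have hgraph : ∀ v w, (∀ u, q v u = inner ℂ (t₀.formIncl ht₀ u) w) ↔
      (t₀.formIncl ht₀ v, w) ∈ (pencil t₀ a hdom l).operatorGraph := by
    intro v w
    constructor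
    · intro h
      exact ⟨(t₀.formEquiv ht₀ v).2, fun g => h ((t₀.formEquiv ht₀).symm g)⟩
    · rintro ⟨hv, h⟩ u
      exact h (t₀.formEquiv ht₀ u)
  obtain ⟨R, hR1, hR2⟩ := exists_resolvent_of_lower_bound (t₀.formIncl ht₀)
    (t₀.formIncl_injective ht₀) q (c := 1 / 2) (K := K + 1 / 2) (ε := ε)
    (fun f g => (hM f g)) (by norm_num) (by positivity) hε
    (fun v => by
      have h1 := hK (t₀.formEquiv ht₀ v)
      have h2 := abs_nonneg ((pencil t₀ a hdom l).quad (t₀.formEquiv ht₀ v)).im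
      change _ ≤ ((pencil t₀ a hdom l).quad (t₀.formEquiv ht₀ v)).re
        + (K + 1 / 2) * ‖(t₀.formEquiv ht₀ v : H)‖ ^ 2
      rw [formSpace_norm_sq]
      linarith)
    (by
      rintro v ⟨w, hw⟩
      rcases eq_or_ne (t₀.formIncl ht₀ v) 0 with h0 | h0
      · rw [h0]; simp
      obtain ⟨hv, hvw⟩ := (mem_operatorGraph_iff _ hdl _ _).1 ((hgraph v w).1 hw)
      have h1 := hlow ⟨_, hv⟩ h0
      rw [hvw] at h1
      rwa [hw v])
  refine ⟨t₀.formIncl ht₀ ∘L R, fun y => ?_, fun x => ?_⟩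
  · exact (mem_operatorGraph_iff _ hdl _ _).1 ((hgraph (R y) y).1 (hR1 y))
  · obtain ⟨hx, hspec⟩ := operator_spec _ hdl x
    have h1 := hR2 ((t₀.formEquiv ht₀).symm ⟨x, hx⟩) ((pencil t₀ a hdom l).operator x)
      fun u => hspec (t₀.formEquiv ht₀ u)
    rw [ContinuousLinearMap.comp_apply, h1]
    rfl

theorem isApproxZero_of_mem_pseudoNumRange {κ₀ α₀ κ p C : ℝ}
    (hd : t₀.DenselyDefined)
    (ht₀κ : t₀.BoundedBelowBy κ₀) (haα : a.BoundedBelowBy α₀)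
    (hsub : ∀ f : t₀.domain, (a.quad ⟨f, hdom f.2⟩).re ≤
      C * ((t₀.quad f).re - κ * ‖(f : H)‖ ^ 2) ^ p * (‖(f : H)‖ ^ 2) ^ (1 - p)) {l : ℂ}
    (hl : l ∈ OpFamily.pseudoNumRange fun l => (pencil t₀ a hdom l).operator) :
    PencilBounds.IsApproxZero p C κ κ₀ α₀ l := by
  intro ε hε
  obtain ⟨f, hf0, hf⟩ := (OpFamily.mem_pseudoNumRange_iff _ l).1 hl ε hε
  obtain ⟨hfd, hspec⟩ := operator_spec (pencil t₀ a hdom l) hd f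
  have hn : 0 < ‖(f : H)‖ := norm_pos_iff.2 hf0
  rw [← hspec ⟨f, hfd⟩] at hf
  set g : t₀.domain := ((‖(f : H)‖⁻¹ : ℝ) : ℂ) • ⟨f, hfd⟩ with hg
  have hg1 : ‖(g : H)‖ = 1 := by
    rw [hg, Submodule.coe_smul, norm_smul, Complex.norm_real, Real.norm_of_nonneg (by positivity),
      inv_mul_cancel₀ hn.ne']
  have hgq : ‖(pencil t₀ a hdom l).quad g‖ < ε := by
    have e := quad_smul (pencil t₀ a hdom l) ((‖(f : H)‖⁻¹ : ℝ) : ℂ) ⟨f, hfd⟩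
    change (pencil t₀ a hdom l).quad g = _ at e
    rw [e, norm_mul, Complex.norm_real, Complex.norm_real, Real.norm_of_nonneg (by positivity),
      Real.norm_of_nonneg (by positivity), inv_pow, inv_mul_lt_iff₀ (by positivity), mul_comm]
    exact hf
  have h1 := ht₀κ.2 g
  have h2 := haα.2 ⟨g, hdom g.2⟩
  have h3 := hsub g
  rw [pencil_quad, ht₀κ.quad_eq, haα.quad_eq] at hgq
  simp only [hg1, one_pow, mul_one, Real.one_rpow, Complex.ofReal_one] at h1 h2 h3 hgq
  exact ⟨_, _, h1, h2, h3, hgq⟩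

end

end SesqForm

/-! ### The spectral enclosures -/

theorem theorem7p1 {H : Type*} [NormedAddCommGroup H] [InnerProductSpace ℂ H] [CompleteSpace H]
    (t₀ a : SesqForm H) (ht₀ : t₀.DenselyDefined) (ha : a.DenselyDefined)
    (hclosed : t₀.IsClosedForm) (hdom : t₀.domain ≤ a.domain)
    (κ₀ α₀ κ p C : ℝ) (hκ₀ : 0 ≤ κ₀) (hα₀ : 0 ≤ α₀)
    (ht₀κ : t₀.BoundedBelowBy κ₀) (haα : a.BoundedBelowBy α₀)
    (hκ : κ ≤ κ₀) (hp0 : 0 < p) (hp1 : p < 1) (hC : 0 < C)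
    (hsub : ∀ f : t₀.domain, (a.quad ⟨f, hdom f.2⟩).re ≤
      C * ((t₀.quad f).re - κ * ‖(f : H)‖ ^ 2) ^ p * (‖(f : H)‖ ^ 2) ^ (1 - p))
    (T : ℂ → H →ₗ.[ℂ] H) (hT : T = fun l => (SesqForm.pencil t₀ a hdom l).operator) :
    SesqForm.HolomorphicTypeA (SesqForm.pencil t₀ a hdom) ∧
    OpFamily.spectrum T ⊆ OpFamily.pseudoNumRange T ∧
    OpFamily.pseudoNumRange T ⊆ {z | z.re ≤ 0} ∧
    -- the non-real spectrum
    (OpFamily.spectrum T \ {z | z.im = 0} ⊆ OpFamily.pseudoNumRange T \ {z | z.im = 0} ∧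
      OpFamily.pseudoNumRange T \ {z | z.im = 0} ⊆
        {z | z.re ≤ -α₀ ∧ √κ₀ ≤ ‖z‖ ∧
          √(max 0 (C ^ (-1 / p) * |z.re| ^ (1 / p) - |z.re| ^ 2 + κ)) ≤ |z.im|}) ∧
    -- the real spectrum, bounded case
    ((p < 1 / 2 ∨ (p = 1 / 2 ∧ C < 1) ∨ (p = 1 / 2 ∧ C = 1 ∧ 0 < κ)) →
      (PencilBounds.D p C κ κ₀ = ∅ ∧ OpFamily.realSpectrum T = ∅) ∨
      ∃ sm sp : ℝ,
        IsLeast (PencilBounds.gMinus p C κ '' PencilBounds.D p C κ κ₀) sm ∧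
        IsGreatest (PencilBounds.gPlus p C κ '' PencilBounds.D p C κ κ₀) sp ∧
        sm ≤ sp ∧ sp ≤ 0 ∧ OpFamily.realSpectrum T ⊆ Set.Icc sm sp) ∧
    -- the real spectrum, unbounded case
    ((1 / 2 < p ∨ (p = 1 / 2 ∧ 1 < C) ∨ (p = 1 / 2 ∧ C = 1 ∧ κ ≤ 0)) →
      (∃ xm xp rp sm sp : ℝ, κ₀ ≤ xm ∧ xm < xp ∧
        PencilBounds.D p C κ κ₀ = Set.Icc κ₀ xm ∪ Set.Ici xp ∧
        IsGreatest (PencilBounds.gPlus p C κ '' Set.Ici xp) rp ∧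
        IsLeast (PencilBounds.gMinus p C κ '' Set.Icc κ₀ xm) sm ∧
        IsGreatest (PencilBounds.gPlus p C κ '' Set.Icc κ₀ xm) sp ∧
        rp < sm ∧ sm ≤ sp ∧ sp ≤ 0 ∧
        OpFamily.realSpectrum T ⊆ Set.Iic rp ∪ Set.Icc sm sp) ∨
      (∃ x sp : ℝ, κ₀ ≤ x ∧ PencilBounds.D p C κ κ₀ = Set.Ici x ∧
        IsGreatest (PencilBounds.gPlus p C κ '' Set.Ici x) sp ∧
        sp ≤ 0 ∧ OpFamily.realSpectrum T ⊆ Set.Iic sp)) ∧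
    -- explicit bounds for `κ = 0`, `p < 1/2`
    (κ = 0 → p < 1 / 2 →
      ((C ^ 2) ^ (1 / (1 - 2 * p)) < κ₀ → OpFamily.realSpectrum T = ∅) ∧
      (κ₀ ≤ (C ^ 2) ^ (1 / (1 - 2 * p)) → OpFamily.realSpectrum T ⊆
        Set.Icc
          (-(C * PencilBounds.tZero p C κ₀ ^ p)
            - √(C ^ 2 * PencilBounds.tZero p C κ₀ ^ (2 * p) - PencilBounds.tZero p C κ₀))
          (-(C * κ₀ ^ p) + √(C ^ 2 * κ₀ ^ (2 * p) - κ₀)))) ∧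
    -- explicit bounds for `κ = 0`, `p = 1/2`
    (κ = 0 → p = 1 / 2 →
      (C < 1 → 0 < κ₀ → OpFamily.realSpectrum T = ∅) ∧
      (C < 1 → κ₀ = 0 → OpFamily.realSpectrum T ⊆ {0}) ∧
      (1 ≤ C → OpFamily.realSpectrum T ⊆ Set.Iic (-((C - √(C ^ 2 - 1)) * κ₀ ^ (1 / 2 : ℝ))))) ∧
    -- explicit bounds for `κ = 0`, `p > 1/2`
    (κ = 0 → 1 / 2 < p →
      (0 < κ₀ → OpFamily.realSpectrum T ⊆
        Set.Iic (-(C * PencilBounds.tZero p C κ₀ ^ p)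
          + √(C ^ 2 * PencilBounds.tZero p C κ₀ ^ (2 * p) - PencilBounds.tZero p C κ₀))) ∧
      (κ₀ = 0 → OpFamily.realSpectrum T ⊆
        Set.Iic (-(C * PencilBounds.tZero p C κ₀ ^ p)
          + √(C ^ 2 * PencilBounds.tZero p C κ₀ ^ (2 * p) - PencilBounds.tZero p C κ₀)) ∪ {0})) := by
  have ht₀0 : t₀.BoundedBelowBy 0 := ht₀κ.mono hκ₀
  have ha0 : a.BoundedBelowBy 0 := haα.mono hα₀
  have hrel : SesqForm.IsRelativelySmall t₀ a hdom :=
    SesqForm.isRelativelySmall_of_rpow ht₀κ hκ hp0 hp1 hC hsub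
  have hspec : OpFamily.spectrum T ⊆ OpFamily.pseudoNumRange T := by
    rw [hT]; exact SesqForm.spectrum_subset_pseudoNumRange ht₀0 ha0 hrel ht₀ hclosed
  have happ : ∀ l ∈ OpFamily.pseudoNumRange T, PencilBounds.IsApproxZero p C κ κ₀ α₀ l := by
    intro l hl
    rw [hT] at hl
    exact SesqForm.isApproxZero_of_mem_pseudoNumRange ht₀ ht₀κ haα hsub hl
  have hreal : OpFamily.realSpectrum T ⊆ PencilBounds.realRegion p C κ κ₀ := fun x hx =>
    (happ _ (hspec hx)).mem_realRegion hκ₀ hα₀ hκ hp0 hp1 hC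
  refine ⟨SesqForm.pencil_holomorphicTypeA ht₀0 ha0 hrel ht₀ hclosed, hspec,
    fun l hl => (happ l hl).re_nonpos hκ₀ hα₀ hp0,
    ⟨Set.sdiff_subset_sdiff_left hspec,
      fun l hl => (happ l hl.1).nonreal_bounds hα₀ hκ hp0 hC hl.2⟩, ?_, ?_, ?_, ?_, ?_⟩
  · intro h
    rcases PencilBounds.realRegion_subset_of_bounded hκ₀ hκ hp0 hC h with
      ⟨h1, h2⟩ | ⟨sm, sp, h1, h2, h3, h4, h5⟩
    · exact Or.inl ⟨h1, Set.subset_empty_iff.1 (h2 ▸ hreal)⟩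
    · exact Or.inr ⟨sm, sp, h1, h2, h3, h4, hreal.trans h5⟩
  · intro h
    rcases PencilBounds.realRegion_subset_of_unbounded hκ₀ hκ hp0 hp1 hC h with
      ⟨xm, xp, rp, sm, sp, h1, h2, h3, h4, h5, h6, h7, h8, h9, h10⟩ | ⟨x, sp, h1, h2, h3, h4, h5⟩
    · exact Or.inl ⟨xm, xp, rp, sm, sp, h1, h2, h3, h4, h5, h6, h7, h8, h9, hreal.trans h10⟩
    · exact Or.inr ⟨x, sp, h1, h2, h3, h4, hreal.trans h5⟩
  · rintro rfl hp
    exact ⟨fun h => Set.subset_empty_iff.1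
        (PencilBounds.realRegion_eq_empty hκ₀ hp0 hp hC h ▸ hreal),
      fun _ z hz => ⟨PencilBounds.gMinus_tZero_le_of_mem_realRegion hκ₀ hp0 hp hC (hreal hz),
        PencilBounds.le_gPlus_of_mem_realRegion hκ₀ hp0 hp.le (hreal hz)⟩⟩
  · rintro rfl rfl
    exact ⟨fun h1 h2 => Set.subset_empty_iff.1
        ((PencilBounds.realRegion_half_subset hκ₀ hC h1).1 h2 ▸ hreal),
      fun h1 _ => hreal.trans (PencilBounds.realRegion_half_subset hκ₀ hC h1).2,
      fun _ => hreal.trans (PencilBounds.realRegion_half_subset_Iic hκ₀)⟩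
  · rintro rfl hp
    refine ⟨fun h z hz => ?_, fun h z hz => ?_⟩
    · refine PencilBounds.le_gPlus_tZero_of_mem_realRegion hκ₀ hp hp1 hC (hreal hz) ?_
      -- at `z = 0` the defining inequality would force `t ≤ 0 < κ₀`
      rintro rfl
      obtain ⟨-, t, ht, hle⟩ := hreal hz
      norm_num at hle
      linarith
    · rcases eq_or_ne z 0 with hz0 | hz0
      · exact Or.inr hz0
      · exact Or.inl
          (PencilBounds.le_gPlus_tZero_of_mem_realRegion hκ₀ hp hp1 hC (hreal hz) hz0)
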